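/- Let $\Omega\subset\mathbb R^3$ be a bounded open set whose boundary $\Gamma=\partial\Omega$ is a smooth ($C^\infty$) two-dimensional embedded surface without boundary, with outer unit normal field $n:\Gamma\to\mathbb R^3$ (so that $\Omega$ lies locally on one side of $\Gamma$, and $n$ points away from $\Omega$). For a differentiable field $f:\Gamma\to\mathbb R^3$ and $s\in\Gamma$, let $D_\Gamma f(s)\in\mathbb R^{3\times 3}$ denote its tangential derivative: it is the derivative of $f$ along $\Gamma$ on the tangent plane $T_s\Gamma$, and $D_\Gamma f(s)\,n(s)=0$ (thus $D_\Gamma f=Df-(Df)\,n\,n^\top$ for any differentiable extension of $f$ to a neighborhood of $\Gamma$). The tangential divergence is $\operatorname{div}_\Gamma W=\sum_{i=1}^2 \xi_i^\top (D_\Gamma W)\,\xi_i$, where $\{\xi_1,\xi_2\}$ is an orthonormal basis of the tangent plane. The principal curvatures $k_1,k_2$ are the eigenvalues, counted with multiplicity, of the shape operator $\xi\mapsto (D_\Gamma n)\,\xi$ on the tangent plane, and $\mathrm ds$ is the surface measure on $\Gamma$. Let $a,b,V:\Gamma\to\mathbb R^3$ be $C^1$ vector fields (not necessarily tangential), and suppose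 that $V$ is normal, i.e., $V=(V^\top n)\,n$ on $\Gamma$. Then both of the following integrands are integrable over $\Gamma$, and $$\int_\Gamma a^\top (D_\Gamma V)\, b\,\mathrm ds=\int_\Gamma V^\top n\,\Bigl[-\operatorname{div}_\Gamma\bigl((a^\top n)\,b\bigr)+(a^\top n)(b^\top n)(k_1+k_2)+a^\top (D_\Gamma n)\,b\Bigr]\,\mathrm ds .$$ -/

import Mathlib

open MeasureTheory Set Filter Topology
open scoped ContDiff RealInnerProductSpace

noncomputable section

namespace SurfaceCalculus

/-- Euclidean three-space. -/
abbrev E3 : Type := EuclideanSpace ℝ (Fin 3)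

/-- `Γ` is a smooth two-dimensional manifold without boundary, embedded in `ℝ³`: near each of
its points it is the zero set of a smooth function whose derivative does not vanish. -/
def IsSmoothSurface (Γ : Set E3) : Prop :=
  ∀ p ∈ Γ, ∃ (U : Set E3) (F : E3 → ℝ), IsOpen U ∧ p ∈ U ∧ ContDiffOn ℝ ∞ F U ∧
    (∀ x ∈ U, fderiv ℝ F x ≠ 0) ∧ Γ ∩ U = {x | x ∈ U ∧ F x = 0}

/-- The tangent plane of `Γ` at `s`, as a linear subspace of `ℝ³`: the span of all limits of
rescaled secant directions of `Γ` at `s`. -/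
def tangentPlane (Γ : Set E3) (s : E3) : Submodule ℝ E3 :=
  Submodule.span ℝ (tangentConeAt ℝ Γ s)

/-- `n` is the outer unit normal field along the boundary of `Ω`. Only the values of `n` on
the boundary matter. -/
def IsOuterUnitNormal (Ω : Set E3) (n : E3 → E3) : Prop :=
  ∀ s ∈ frontier Ω, ‖n s‖ = 1 ∧ n s ∈ (tangentPlane (frontier Ω) s)ᗮ ∧
    ∀ᶠ t : ℝ in 𝓝[>] 0, s - t • n s ∈ Ω ∧ s + t • n s ∉ closure Ω

/-- The tangential derivative `D_Γ f` at `s` of a field `f` on `Γ`, as a linear map on `ℝ³` which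
vanishes in the normal direction, so that `D_Γ f = Df - (Df) n nᵀ` if `f` is differentiable near
`Γ`. Mathlib's `fderivWithin` is a linear map approximating `f` along `Γ`; it is unique only on
the tangent plane, and the projection removes the ambiguity, see `tangentialDeriv_eq`. -/
def tangentialDeriv (Γ : Set E3) (f : E3 → E3) (s : E3) : E3 →L[ℝ] E3 :=
  (fderivWithin ℝ f Γ s).comp (tangentPlane Γ s).starProjection

theorem tangentialDeriv_eq {Γ : Set E3} {f : E3 → E3} {s : E3} {L : E3 →L[ℝ] E3}
    (h : HasFDerivWithinAt f L Γ s) :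
    tangentialDeriv Γ f s = L.comp (tangentPlane Γ s).starProjection := by
  have key : ∀ v ∈ tangentPlane Γ s, fderivWithin ℝ f Γ s v = L v := by
    intro v hv
    have h1 := h.differentiableWithinAt.hasFDerivWithinAt
    refine LinearMap.eqOn_span (f := (fderivWithin ℝ f Γ s).toLinearMap)
      (g := L.toLinearMap) (fun w hw => ?_) hv
    exact HasFDerivWithinAt.unique_on h1 h hw
  ext1 v
  exact key _ (Submodule.starProjection_apply_mem _ v)

/-- The tangential divergence `div_Γ W = ∑ i, ξᵢᵀ (D_Γ W) ξᵢ`, with `ξ` an orthonormal basis of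
the tangent plane. -/
def tangentialDiv (Γ : Set E3) (W : E3 → E3) (s : E3) : ℝ :=
  ∑ i, ⟪(stdOrthonormalBasis ℝ (tangentPlane Γ s) i : E3),
    tangentialDeriv Γ W s (stdOrthonormalBasis ℝ (tangentPlane Γ s) i : E3)⟫

/-- The shape operator: the derivative of the normal field `n` at `s`, as an endomorphism of the
tangent plane. (Its values are tangent, so that the projection only changes the codomain.) -/
def shapeOperator (Γ : Set E3) (n : E3 → E3) (s : E3) :
    tangentPlane Γ s →ₗ[ℝ] tangentPlane Γ s :=
  ((tangentPlane Γ s).orthogonalProjectionOnto.comp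
    ((tangentialDeriv Γ n s).comp (tangentPlane Γ s).subtypeL)).toLinearMap

/-- The principal curvatures: the eigenvalues of the shape operator, with multiplicity. -/
def principalCurvatures (Γ : Set E3) (n : E3 → E3) (s : E3) : Multiset ℝ :=
  (shapeOperator Γ n s).charpoly.roots

/-- Surface measure on `Γ`: the two-dimensional Hausdorff measure, normalised so that it is
Lebesgue measure on planes. -/
def surfaceMeasure (Γ : Set E3) : Measure E3 :=
  (μHE[2] : Measure E3).restrict Γ

end SurfaceCalculus

end

open SurfaceCalculus

/-! Write `v = ⟪V, n⟫` and `W = ⟪a, n⟫ • b`. Since `V = v n` on the surface, the product rule gives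
`aᵀ (D_Γ V) b = v aᵀ (D_Γ n) b + ⟪a, n⟫ ∇_Γ v · b`. The last term is the gradient part of `div_Γ (v
W) = v div_Γ W + ∇_Γ v · W`. With `k₁ + k₂ = div_Γ n`, the two integrands therefore differ pointwise
by `div_Γ Z - (div_Γ n) ⟪Z, n⟫` for `Z = v W`. This is `divergenceDefect`, and the theorem reduces
to the divergence theorem `integral_divergenceDefect_eq_zero` on a closed surface.

A partition of unity reduces that theorem to a field supported in one chart `φ`. There the surface
measure becomes `normDet (Dφ)` by the area formula, and up to a constant sign this Jacobian is `det
(∂₁φ, ∂₂φ, n)`. Multiplied by this determinant, the defect is the planar divergence of `(det (Z,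
∂₂φ, n), det (∂₁φ, Z, n))` (`tripleProduct_mul_divergenceDefect`), a compactly supported `C¹` field,
so its integral vanishes.

Two geometric facts support this. The outer normal is `C¹` (`contDiffOn_outerUnitNormal`), being
locally a normalised gradient with a fixed sign. The shape operator is symmetric
(`isSymmetric_shapeOperator`), so its real eigenvalues add up to its trace `div_Γ n`. -/

section AreaFormula

/-! ### Area formula for injective `C¹` immersions. -/

open Module NNReal ENNReal

/-- On `E` the map `φ` factors through `ψ` by a `c`-Lipschitz map, because `ψ x = ψ y` forces `φ x =
φ y`. The symmetric form lets a nonlinear map and its linearisation be compared in both directions.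
-/
theorem euclideanHausdorffMeasure_image_le_of_dist_le {X Y Z : Type*} [MetricSpace Y]
    [MeasurableSpace Y] [BorelSpace Y] [MetricSpace Z] [MeasurableSpace Z] [BorelSpace Z]
    {φ : X → Y} {ψ : X → Z} {E : Set X} {c : ℝ≥0}
    (h : ∀ x ∈ E, ∀ y ∈ E, dist (φ x) (φ y) ≤ c * dist (ψ x) (ψ y)) (d : ℕ) :
    (μHE[d] : Measure Y) (φ '' E) ≤ (c : ℝ≥0∞) ^ d * (μHE[d] : Measure Z) (ψ '' E) := by
  rcases E.eq_empty_or_nonempty with rfl | ⟨x₀, hx₀⟩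
  · simp
  have : Nonempty X := ⟨x₀⟩
  have hinv : ∀ x ∈ E, φ (Function.invFunOn ψ E (ψ x)) = φ x := fun x hx => by
    have h1 := Function.invFunOn_mem (f := ψ) (s := E) ⟨x, hx, rfl⟩
    have h2 := Function.invFunOn_eq (f := ψ) (s := E) ⟨x, hx, rfl⟩
    have h3 := h _ h1 x hx
    rw [h2, dist_self, mul_zero] at h3
    exact dist_le_zero.1 h3
  have himg : φ '' E = (φ ∘ Function.invFunOn ψ E) '' (ψ '' E) := by
    rw [image_image]
    exact image_congr fun x hx => (hinv x hx).symm
  have hlip : LipschitzOnWith c (φ ∘ Function.invFunOn ψ E) (ψ '' E) := by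
    refine LipschitzOnWith.of_dist_le_mul ?_
    rintro _ ⟨x, hx, rfl⟩ _ ⟨y, hy, rfl⟩
    simp only [Function.comp_apply]
    rw [hinv x hx, hinv y hy]
    exact h x hx y hy
  have h4 := hlip.hausdorffMeasure_image_le (d := d) (by positivity)
  rw [← himg, ENNReal.rpow_natCast] at h4
  simp only [Measure.euclideanHausdorffMeasure_def, Measure.smul_apply, Measure.nnreal_smul_coe_apply]
  rw [mul_left_comm]
  gcongr

set_option linter.unusedSectionVars false

variable {U V : Type*} [NormedAddCommGroup U] [InnerProductSpace ℝ U] [FiniteDimensional ℝ U]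
  [NormedAddCommGroup V] [InnerProductSpace ℝ V] [FiniteDimensional ℝ V]

theorem continuous_normDet : Continuous fun f : U →L[ℝ] V => f.toLinearMap.normDet := by
  have h : (fun f : U →L[ℝ] V => f.toLinearMap.normDet) =
      fun f : U →L[ℝ] V => √((f.adjoint ∘L f).det) := by
    funext f
    have := f.normDet_sq
    rw [← this]
    exact (Real.sqrt_sq f.toLinearMap.normDet_nonneg).symm
  rw [h]
  refine Real.continuous_sqrt.comp (ContinuousLinearMap.continuous_det.comp ?_)
  have : Continuous fun f : U →L[ℝ] V => f.adjoint :=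
    (ContinuousLinearMap.adjoint (𝕜 := ℝ) (E := U) (F := V)).continuous
  exact this.clm_comp continuous_id

theorem normDet_pos {f : U →L[ℝ] V} (h : Function.Injective f) : 0 < f.toLinearMap.normDet := by
  refine lt_of_le_of_ne f.toLinearMap.normDet_nonneg (Ne.symm ?_)
  rw [Ne, LinearMap.normDet_eq_zero_iff_ker_ne_bot, not_not]
  exact LinearMap.ker_eq_bot.2 h

/-- A strictly differentiable map is, near a point where its derivative `A` is injective,
bi-Lipschitz to `A` with constants as close to one as desired. -/
theorem HasStrictFDerivAt.exists_dist_le {φ : U → V} {A : U →L[ℝ] V} {u : U}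
    (h : HasStrictFDerivAt φ A u) (hA : Function.Injective A) {c : ℝ} (hc : 1 < c) :
    ∃ N ∈ 𝓝 u, ∀ x ∈ N, ∀ y ∈ N, dist (φ x) (φ y) ≤ c * dist (A x) (A y) ∧
      dist (A x) (A y) ≤ c * dist (φ x) (φ y) := by
  obtain ⟨K, hK, hAK⟩ := A.toLinearMap.exists_antilipschitzWith (LinearMap.ker_eq_bot.2 hA)
  have hKpos : (0 : ℝ) < K := hK
  have hAK' : ∀ x y, dist x y ≤ K * dist (A x) (A y) := fun x y => hAK.le_mul_dist x y
  -- With `K` the antilipschitz constant of `A`, this makes the linearisation error at most `(1 -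
  -- c⁻¹) ‖A x - A y‖`. Hence `‖φ x - φ y‖` lies between `c⁻¹` and `2 - c⁻¹ ≤ c` times `‖A x - A
  -- y‖`.
  set ε : ℝ := (1 - c⁻¹) / K with hε
  have hc0 : 0 < c := by linarith
  have hcinv : c⁻¹ < 1 := inv_lt_one_of_one_lt₀ hc
  have hεpos : 0 < ε := div_pos (by linarith) hKpos
  obtain ⟨s, hs, hlin⟩ := h.approximates_deriv_on_nhds (c := ⟨ε, hεpos.le⟩) (Or.inr hεpos)
  refine ⟨s, hs, fun x hx y hy => ?_⟩
  have h1 := hlin x hx y hy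
  have h2 : ε * ‖x - y‖ ≤ (1 - c⁻¹) * ‖A x - A y‖ := by
    have := hAK' x y
    rw [dist_eq_norm, dist_eq_norm] at this
    calc ε * ‖x - y‖ ≤ ε * (K * ‖A x - A y‖) := by gcongr
      _ = _ := by rw [hε]; field_simp
  have h3 : ‖φ x - φ y - (A x - A y)‖ ≤ (1 - c⁻¹) * ‖A x - A y‖ := by
    rw [← map_sub]
    refine le_trans h1 ?_
    rw [map_sub] at *
    exact h2
  rw [dist_eq_norm, dist_eq_norm]
  have h4 : ‖φ x - φ y‖ ≤ ‖A x - A y‖ + ‖φ x - φ y - (A x - A y)‖ := norm_le_norm_add_norm_sub' _ _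
  have h5 : ‖A x - A y‖ ≤ ‖φ x - φ y‖ + ‖φ x - φ y - (A x - A y)‖ := norm_le_norm_add_norm_sub _ _
  have h6 := norm_nonneg (A x - A y)
  have h7 : 2 - c⁻¹ ≤ c := by
    have : c * c⁻¹ = 1 := mul_inv_cancel₀ hc0.ne'
    nlinarith [sq_nonneg (c - 1), inv_pos.2 hc0]
  constructor
  · nlinarith
  · have : c⁻¹ * ‖A x - A y‖ ≤ ‖φ x - φ y‖ := by linarith
    calc ‖A x - A y‖ = c * (c⁻¹ * ‖A x - A y‖) := by field_simp
      _ ≤ _ := by gcongr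

variable [MeasurableSpace U] [BorelSpace U] [MeasurableSpace V] [BorelSpace V]

/-- Freeze the derivative at `u`, where the formula is linear algebra. Comparing `φ` with this
linear map costs `c` to the dimension, and the variation of the Jacobian over `N` costs one more
factor `c`. -/
theorem exists_nhds_euclideanHausdorffMeasure_image_le {φ : U → V} {D : Set U} (hD : IsOpen D)
    (hφ : ContDiffOn ℝ 1 φ D) (himm : ∀ u ∈ D, Function.Injective (fderiv ℝ φ u))
    {u : U} (hu : u ∈ D) {c : ℝ≥0} (hc : 1 < c) :
    ∃ N, IsOpen N ∧ u ∈ N ∧ N ⊆ D ∧ ∀ E ⊆ N, MeasurableSet E →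
      μHE[finrank ℝ U] (φ '' E) ≤ (c : ℝ≥0∞) ^ (finrank ℝ U + 1) *
        ∫⁻ x in E, ENNReal.ofReal (fderiv ℝ φ x).toLinearMap.normDet ∧
      ∫⁻ x in E, ENNReal.ofReal (fderiv ℝ φ x).toLinearMap.normDet ≤
        (c : ℝ≥0∞) ^ (finrank ℝ U + 1) * μHE[finrank ℝ U] (φ '' E) := by
  set A := fderiv ℝ φ u with hA
  set J : U → ℝ := fun x => (fderiv ℝ φ x).toLinearMap.normDet with hJ
  have hJu : 0 < J u := normDet_pos (himm u hu)
  have hJc : ContinuousAt J u :=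
    (continuous_normDet.continuousAt).comp
      ((hφ.continuousOn_fderiv_of_isOpen hD le_rfl).continuousAt (hD.mem_nhds hu))
  have hc' : (1 : ℝ) < c := by exact_mod_cast hc
  have hst : HasStrictFDerivAt φ A u :=
    (hφ.contDiffAt (hD.mem_nhds hu)).hasStrictFDerivAt one_ne_zero
  obtain ⟨N₁, hN₁, hdist⟩ := hst.exists_dist_le (himm u hu) hc'
  have hlt1 : ∀ᶠ x in 𝓝 u, J x < c * J u :=
    hJc.eventually_lt_const (by nlinarith)
  have hlt2 : ∀ᶠ x in 𝓝 u, J u < c * J x := by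
    have : ContinuousAt (fun x => c * J x) u := continuousAt_const.mul hJc
    exact this.eventually_const_lt (by nlinarith)
  obtain ⟨N, hNsub, hNo, huN⟩ := mem_nhds_iff.1
    (inter_mem hN₁ (inter_mem (hD.mem_nhds hu) (inter_mem hlt1 hlt2)))
  refine ⟨N, hNo, huN, fun x hx => (hNsub hx).2.1, fun E hE hEm => ?_⟩
  have hlin : μHE[finrank ℝ U] (A '' E) = ENNReal.ofReal (J u) * volume E :=
    A.toLinearMap.euclideanHausdorffMeasure_image_eq_normDet_mul_volume E
  have hcoe : (c : ℝ≥0∞) = ENNReal.ofReal c := by simp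
  have hlow : ENNReal.ofReal (J u) * volume E ≤ c * ∫⁻ x in E, ENNReal.ofReal (J x) := by
    rw [← setLIntegral_const, ← lintegral_const_mul' _ _ (by simp)]
    refine setLIntegral_mono' hEm fun x hx => ?_
    rw [hcoe, ← ENNReal.ofReal_mul (by positivity)]
    exact ENNReal.ofReal_le_ofReal (hNsub (hE hx)).2.2.2.le
  have hupp : ∫⁻ x in E, ENNReal.ofReal (J x) ≤ c * (ENNReal.ofReal (J u) * volume E) := by
    rw [← setLIntegral_const, ← lintegral_const_mul' _ _ (by simp)]
    refine setLIntegral_mono' hEm fun x hx => ?_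
    rw [hcoe, ← ENNReal.ofReal_mul (by positivity)]
    exact ENNReal.ofReal_le_ofReal (hNsub (hE hx)).2.2.1.le
  constructor
  · calc _ ≤ (c : ℝ≥0∞) ^ finrank ℝ U * μHE[finrank ℝ U] (A '' E) :=
          euclideanHausdorffMeasure_image_le_of_dist_le
            (fun x hx y hy => (hdist x (hNsub (hE hx)).1 y (hNsub (hE hy)).1).1) _
      _ ≤ (c : ℝ≥0∞) ^ finrank ℝ U * (c * ∫⁻ x in E, ENNReal.ofReal (J x)) := by
          rw [hlin]; gcongr
      _ = _ := by ring
  · calc _ ≤ c * (ENNReal.ofReal (J u) * volume E) := hupp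
      _ = c * μHE[finrank ℝ U] (A '' E) := by rw [hlin]
      _ ≤ c * ((c : ℝ≥0∞) ^ finrank ℝ U * μHE[finrank ℝ U] (φ '' E)) := by
          gcongr
          exact euclideanHausdorffMeasure_image_le_of_dist_le
            (fun x hx y hy => (hdist x (hNsub (hE hx)).1 y (hNsub (hE hy)).1).2) _
      _ = _ := by ring

/-- The **area formula** for injective immersions of class `C¹`. -/
theorem euclideanHausdorffMeasure_image_eq_lintegral_normDet {φ : U → V} {D : Set U}
    (hD : IsOpen D) (hφ : ContDiffOn ℝ 1 φ D) (hinj : InjOn φ D)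
    (himm : ∀ u ∈ D, Function.Injective (fderiv ℝ φ u)) {E : Set U} (hE : MeasurableSet E)
    (hED : E ⊆ D) :
    μHE[finrank ℝ U] (φ '' E) =
      ∫⁻ x in E, ENNReal.ofReal (fderiv ℝ φ x).toLinearMap.normDet := by
  set I : Set U → ℝ≥0∞ := fun E => ∫⁻ x in E, ENNReal.ofReal (fderiv ℝ φ x).toLinearMap.normDet
  set ν : Set U → ℝ≥0∞ := fun E => μHE[finrank ℝ U] (φ '' E)
  change ν E = I E
  -- Countably many of the local neighbourhoods cover `D`. Made disjoint, they let the local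
  -- estimates be summed with the same constant, and `c` then tends to `1`. Injectivity keeps the
  -- images of the pieces disjoint.
  have key : ∀ c : ℝ≥0, 1 < c → ν E ≤ (c : ℝ≥0∞) ^ (finrank ℝ U + 1) * I E ∧
      I E ≤ (c : ℝ≥0∞) ^ (finrank ℝ U + 1) * ν E := by
    intro c hc
    choose! N hNo hNu hND hN using fun u (hu : u ∈ D) =>
      exists_nhds_euclideanHausdorffMeasure_image_le hD hφ himm hu hc
    obtain ⟨t, htD, htc, ht⟩ := TopologicalSpace.countable_cover_nhdsWithin
      (fun u hu => mem_nhdsWithin_of_mem_nhds ((hNo u hu).mem_nhds (hNu u hu)))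
    rcases t.eq_empty_or_nonempty with rfl | htne
    · have : E = ∅ := by simpa using hED.trans ht
      simp [this, ν, I]
    obtain ⟨f, rfl⟩ := htc.exists_eq_range htne
    have hf : ∀ i, f i ∈ D := fun i => htD ⟨i, rfl⟩
    set M : ℕ → Set U := fun i => E ∩ disjointed (fun i => N (f i)) i
    have hMm : ∀ i, MeasurableSet (M i) := fun i =>
      hE.inter (MeasurableSet.disjointed (fun j => (hNo _ (hf j)).measurableSet) i)
    have hMN : ∀ i, M i ⊆ N (f i) := fun i =>
      inter_subset_right.trans (disjointed_subset _ i)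
    have hMd : Pairwise fun i j => Disjoint (M i) (M j) := fun i j hij =>
      ((disjoint_disjointed _) hij).mono inter_subset_right inter_subset_right
    have hME : ⋃ i, M i = E := by
      rw [← inter_iUnion, iUnion_disjointed, inter_eq_left]
      exact hED.trans (by simpa using ht)
    have hMD : ∀ i, M i ⊆ D := fun i => inter_subset_left.trans hED
    have hI : I E = ∑' i, I (M i) := by
      simp only [I]
      rw [← lintegral_iUnion hMm hMd, hME]
    have hν : ν E = ∑' i, ν (M i) := by
      simp only [ν]
      rw [← measure_iUnion, ← image_iUnion, hME]
      · intro i j hij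
        refine disjoint_left.2 ?_
        rintro _ ⟨x, hx, rfl⟩ ⟨y, hy, hxy⟩
        rw [hinj (hMD j hy) (hMD i hx) hxy] at hy
        exact disjoint_left.1 (hMd hij) hx hy
      · exact fun i => (hMm i).image_of_continuousOn_injOn (hφ.continuousOn.mono (hMD i))
          (hinj.mono (hMD i))
    rw [hI, hν, ← ENNReal.tsum_mul_left, ← ENNReal.tsum_mul_left]
    exact ⟨ENNReal.tsum_le_tsum fun i => (hN _ (hf i) _ (hMN i) (hMm i)).1,
      ENNReal.tsum_le_tsum fun i => (hN _ (hf i) _ (hMN i) (hMm i)).2⟩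
  have lim : ∀ A B : ℝ≥0∞, (∀ c : ℝ≥0, 1 < c → A ≤ (c : ℝ≥0∞) ^ (finrank ℝ U + 1) * B) →
      A ≤ B := by
    intro A B h
    rcases eq_or_ne B ∞ with rfl | hB
    · exact le_top
    have ht : Tendsto (fun c : ℝ≥0 => (c : ℝ≥0∞) ^ (finrank ℝ U + 1) * B) (𝓝[>] 1)
        (𝓝 (((1 : ℝ≥0) : ℝ≥0∞) ^ (finrank ℝ U + 1) * B)) := by
      refine ENNReal.Tendsto.mul_const ?_ (Or.inr hB)
      refine (ENNReal.Tendsto.pow ?_)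
      exact ENNReal.tendsto_coe.2 (tendsto_id.mono_left nhdsWithin_le_nhds)
    rw [ENNReal.coe_one, one_pow, one_mul] at ht
    exact ge_of_tendsto ht (eventually_nhdsWithin_of_forall fun c hc => h c hc)
  exact le_antisymm (lim _ _ fun c hc => (key c hc).1) (lim _ _ fun c hc => (key c hc).2)

theorem aemeasurable_normDet_fderiv {φ : U → V} {D : Set U} (hD : IsOpen D)
    (hφ : ContDiffOn ℝ 1 φ D) :
    AEMeasurable (fun x => (fderiv ℝ φ x).toLinearMap.normDet.toNNReal) (volume.restrict D) := by
  have : ContinuousOn (fun x => (fderiv ℝ φ x).toLinearMap.normDet.toNNReal) D :=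
    (continuous_real_toNNReal.comp continuous_normDet).comp_continuousOn
      (hφ.continuousOn_fderiv_of_isOpen hD le_rfl)
  exact this.aemeasurable hD.measurableSet

/-- The area formula as an identity of measures, from which the change of variables for real
integrands follows by `integral_map`. -/
theorem map_withDensity_normDet {φ : U → V} {D : Set U} (hD : IsOpen D)
    (hφ : ContDiffOn ℝ 1 φ D) (hinj : InjOn φ D)
    (himm : ∀ u ∈ D, Function.Injective (fderiv ℝ φ u)) :
    ((volume.restrict D).withDensity
      fun x => ENNReal.ofReal (fderiv ℝ φ x).toLinearMap.normDet).map φ =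
      (μHE[finrank ℝ U] : Measure V).restrict (φ '' D) := by
  have hφm : AEMeasurable φ ((volume.restrict D).withDensity
      fun x => ENNReal.ofReal (fderiv ℝ φ x).toLinearMap.normDet) :=
    (hφ.continuousOn.aemeasurable hD.measurableSet).mono_ac (withDensity_absolutelyContinuous _ _)
  ext A hA
  have hm : MeasurableSet (D ∩ φ ⁻¹' A) := by
    obtain ⟨u, hu, huD⟩ : ∃ u : U → V, Measurable u ∧ EqOn u φ D := by
      classical
      exact ⟨D.piecewise φ 0, hφ.continuousOn.measurable_piecewise continuous_zero.continuousOn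
        hD.measurableSet, D.piecewise_eqOn _ _⟩
    have : D ∩ φ ⁻¹' A = D ∩ u ⁻¹' A := by
      ext x
      simp only [mem_inter_iff, mem_preimage, and_congr_right_iff]
      intro hx
      rw [huD hx]
    rw [this]
    exact hD.measurableSet.inter (hu hA)
  rw [Measure.map_apply_of_aemeasurable hφm hA, Measure.restrict_apply hA, inter_comm A,
    ← image_inter_preimage, euclideanHausdorffMeasure_image_eq_lintegral_normDet hD hφ hinj himm hm
      inter_subset_left, ← restrict_withDensity hD.measurableSet,
    Measure.restrict_apply₀', inter_comm, withDensity_apply _ hm]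
  exact hD.measurableSet.nullMeasurableSet

theorem setIntegral_image_eq_integral_normDet_mul {φ : U → V} {D : Set U} (hD : IsOpen D)
    (hφ : ContDiffOn ℝ 1 φ D) (hinj : InjOn φ D)
    (himm : ∀ u ∈ D, Function.Injective (fderiv ℝ φ u)) {g : V → ℝ}
    (hg : ContinuousOn g (φ '' D)) :
    ∫ y in φ '' D, g y ∂(μHE[finrank ℝ U]) =
      ∫ x in D, (fderiv ℝ φ x).toLinearMap.normDet * g (φ x) := by
  have hφm : AEMeasurable φ ((volume.restrict D).withDensity
      fun x => ENNReal.ofReal (fderiv ℝ φ x).toLinearMap.normDet) :=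
    (hφ.continuousOn.aemeasurable hD.measurableSet).mono_ac (withDensity_absolutelyContinuous _ _)
  have hgm : AEStronglyMeasurable g ((μHE[finrank ℝ U] : Measure V).restrict (φ '' D)) :=
    hg.aestronglyMeasurable (hD.measurableSet.image_of_continuousOn_injOn hφ.continuousOn hinj)
  rw [← map_withDensity_normDet hD hφ hinj himm] at hgm ⊢
  rw [integral_map hφm hgm]
  simp only [ENNReal.ofReal]
  rw [integral_withDensity_eq_integral_smul₀ (aemeasurable_normDet_fderiv hD hφ)]
  refine integral_congr_ae (Eventually.of_forall fun x => ?_)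
  simp only [NNReal.smul_def, Real.coe_toNNReal _ (LinearMap.normDet_nonneg _), smul_eq_mul]

end AreaFormula

/-! ### Triple products, traces and a compact-support integral. -/

/-- The Euclidean plane, in which local parametrizations of surfaces are defined. -/
abbrev E2 : Type := EuclideanSpace ℝ (Fin 2)

/-- The scalar triple product of three vectors. -/
def tripleProduct (x y z : E3) : ℝ :=
  x 0 * (y 1 * z 2 - y 2 * z 1) + x 1 * (y 2 * z 0 - y 0 * z 2) + x 2 * (y 0 * z 1 - y 1 * z 0)

theorem trace_eq_sum_coord (A : E3 →L[ℝ] E3) :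
    LinearMap.trace ℝ E3 A.toLinearMap =
      A (EuclideanSpace.single 0 1) 0 + A (EuclideanSpace.single 1 1) 1 +
        A (EuclideanSpace.single 2 1) 2 := by
  rw [LinearMap.trace_eq_sum_inner _ (EuclideanSpace.basisFun (Fin 3) ℝ)]
  simp [Fin.sum_univ_three, EuclideanSpace.inner_single_left]

theorem apply_eq_sum_coord (A : E3 →L[ℝ] E3) (x : E3) (i : Fin 3) :
    A x i = x 0 * A (EuclideanSpace.single 0 1) i + x 1 * A (EuclideanSpace.single 1 1) i +
        x 2 * A (EuclideanSpace.single 2 1) i := by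
  have h : x = x 0 • EuclideanSpace.single 0 (1 : ℝ) + x 1 • EuclideanSpace.single 1 (1 : ℝ) +
      x 2 • EuclideanSpace.single 2 (1 : ℝ) := by
    ext j
    fin_cases j <;> simp
  conv_lhs => rw [h]
  simp [map_add, map_smul]

/-- The derivative of the determinant at the identity is the trace. This is how `div_Γ` emerges from
derivatives of triple products. -/
theorem tripleProduct_trace (A : E3 →L[ℝ] E3) (x y z : E3) :
    tripleProduct (A x) y z + tripleProduct x (A y) z + tripleProduct x y (A z) =
      LinearMap.trace ℝ E3 A.toLinearMap * tripleProduct x y z := by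
  rw [trace_eq_sum_coord]
  simp only [tripleProduct, apply_eq_sum_coord A x, apply_eq_sum_coord A y, apply_eq_sum_coord A z]
  ring

theorem inner_eq_coord (x y : E3) : ⟪x, y⟫ = x 0 * y 0 + x 1 * y 1 + x 2 * y 2 := by
  simp [PiLp.inner_apply, Fin.sum_univ_three, mul_comm]

/-- The squared determinant is the Gram determinant of `x, y, n`, which is block diagonal here. -/
theorem tripleProduct_sq (x y n : E3) (hn : ‖n‖ = 1) (hx : ⟪n, x⟫ = 0) (hy : ⟪n, y⟫ = 0) :
    tripleProduct x y n ^ 2 = ⟪x, x⟫ * ⟪y, y⟫ - ⟪x, y⟫ ^ 2 := by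
  have h : tripleProduct x y n ^ 2 = ⟪n, n⟫ * (⟪x, x⟫ * ⟪y, y⟫ - ⟪x, y⟫ ^ 2)
      - ⟪n, x⟫ ^ 2 * ⟪y, y⟫ - ⟪n, y⟫ ^ 2 * ⟪x, x⟫ + 2 * ⟪n, x⟫ * ⟪n, y⟫ * ⟪x, y⟫ := by
    simp only [tripleProduct, inner_eq_coord]
    ring
  rw [h, hx, hy, real_inner_self_eq_norm_sq n, hn]
  ring

theorem abs_tripleProduct_eq_normDet (A : E2 →L[ℝ] E3) (n : E3) (hn : ‖n‖ = 1)
    (h : ∀ v, ⟪n, A v⟫ = 0) :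
    |tripleProduct (A (EuclideanSpace.single 0 1)) (A (EuclideanSpace.single 1 1)) n| =
      A.toLinearMap.normDet := by
  rw [← abs_of_nonneg A.toLinearMap.normDet_nonneg, ← sq_eq_sq_iff_abs_eq_abs,
    tripleProduct_sq _ _ _ hn (h _) (h _)]
  have := A.toLinearMap.normDet_sq_eq_det_gram (EuclideanSpace.basisFun (Fin 2) ℝ)
  simp only [RCLike.ofReal_real_eq_id, id] at this
  rw [this, Matrix.det_fin_two]
  simp only [Matrix.gram_apply, EuclideanSpace.basisFun_apply, ContinuousLinearMap.coe_coe]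
  rw [real_inner_comm (A (EuclideanSpace.single 0 1)) (A (EuclideanSpace.single 1 1))]
  ring

theorem contDiff_tripleProduct {k : WithTop ℕ∞} :
    ContDiff ℝ k fun p : E3 × E3 × E3 => tripleProduct p.1 p.2.1 p.2.2 := by
  unfold tripleProduct
  fun_prop

theorem fderiv_tripleProduct {F : Type*} [NormedAddCommGroup F] [NormedSpace ℝ F]
    {x y z : F → E3} {u : F} (hx : DifferentiableAt ℝ x u) (hy : DifferentiableAt ℝ y u)
    (hz : DifferentiableAt ℝ z u) (v : F) :
    fderiv ℝ (fun w => tripleProduct (x w) (y w) (z w)) u v =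
      tripleProduct (fderiv ℝ x u v) (y u) (z u) + tripleProduct (x u) (fderiv ℝ y u v) (z u) +
        tripleProduct (x u) (y u) (fderiv ℝ z u v) := by
  have hc : ∀ {x : F → E3}, DifferentiableAt ℝ x u → ∀ i, HasFDerivAt (fun w => x w i)
      ((EuclideanSpace.proj i).comp (fderiv ℝ x u) : F →L[ℝ] ℝ) u := fun hx i =>
    (EuclideanSpace.proj i : E3 →L[ℝ] ℝ).hasFDerivAt.comp u hx.hasFDerivAt
  have h := (((hc hx 0).mul (((hc hy 1).mul (hc hz 2)).sub ((hc hy 2).mul (hc hz 1)))).add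
    ((hc hx 1).mul (((hc hy 2).mul (hc hz 0)).sub ((hc hy 0).mul (hc hz 2))))).add
    ((hc hx 2).mul (((hc hy 0).mul (hc hz 1)).sub ((hc hy 1).mul (hc hz 0))))
  have h2 : HasFDerivAt (fun w => tripleProduct (x w) (y w) (z w)) _ u := h
  rw [h2.fderiv]
  simp [tripleProduct]
  ring

/-- Extended by zero outside `D`, the function is `C¹` with compact support on the whole space.
Integrating by parts against the constant `1` gives the claim. -/
theorem integral_fderiv_eq_zero_of_compact {F : Type*} [NormedAddCommGroup F] [NormedSpace ℝ F]
    [FiniteDimensional ℝ F] [MeasurableSpace F] [BorelSpace F] {μ : Measure F}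
    [μ.IsAddHaarMeasure] {G : F → ℝ} {D K : Set F} (hD : IsOpen D) (hG : ContDiffOn ℝ 1 G D)
    (hK : IsCompact K) (hKD : K ⊆ D) (h0 : ∀ u ∈ D, u ∉ K → G u = 0) (v : F) :
    ∫ u in D, fderiv ℝ G u v ∂μ = 0 := by
  set H : F → ℝ := D.indicator G with hH
  have hloc : ∀ u ∈ D, H =ᶠ[𝓝 u] G := fun u hu =>
    Filter.eventuallyEq_of_mem (hD.mem_nhds hu) fun x hx => indicator_of_mem hx _
  have hloc0 : ∀ u ∉ K, H =ᶠ[𝓝 u] fun _ => 0 := fun u hu =>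
    Filter.eventuallyEq_of_mem (hK.isClosed.isOpen_compl.mem_nhds hu) fun x hx => by
      by_cases hxD : x ∈ D
      · rw [hH, indicator_of_mem hxD, h0 x hxD hx]
      · rw [hH, indicator_of_notMem hxD]
  have hHc : ContDiff ℝ 1 H := contDiff_iff_contDiffAt.2 fun u => by
    by_cases hu : u ∈ D
    · exact (hG.contDiffAt (hD.mem_nhds hu)).congr_of_eventuallyEq (hloc u hu)
    · exact contDiffAt_const.congr_of_eventuallyEq (hloc0 u fun h => hu (hKD h))
  have hsupp : HasCompactSupport H := HasCompactSupport.intro hK fun u hu => (hloc0 u hu).eq_of_nhds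
  have heq : ∫ u in D, fderiv ℝ G u v ∂μ = ∫ u, fderiv ℝ H u v ∂μ := by
    rw [← integral_indicator hD.measurableSet]
    refine integral_congr_ae (Eventually.of_forall fun u => ?_)
    by_cases hu : u ∈ D
    · simp only [indicator_of_mem hu, (hloc u hu).fderiv_eq]
    · simp only [indicator_of_notMem hu, (hloc0 u fun h => hu (hKD h)).fderiv_eq]
      simp
  rw [heq]
  have hint : Integrable (fun u => fderiv ℝ H u v) μ :=
    ((hHc.continuous_fderiv one_ne_zero).clm_apply continuous_const).integrable_of_hasCompactSupport
      (hsupp.fderiv_apply ℝ v)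
  have := integral_mul_fderiv_eq_neg_fderiv_mul_of_integrable (μ := μ) (f := fun _ : F => (1 : ℝ))
    (g := H) (v := v) (by simp) (by simpa using hint)
    (by simpa using hHc.continuous.integrable_of_hasCompactSupport hsupp)
    (fun _ _ => by fun_prop) (fun x _ => hHc.differentiable one_ne_zero x)
  simpa using this

theorem tangentialDeriv_comp_starProjection (Γ : Set E3) (f : E3 → E3) (s : E3) :
    (tangentialDeriv Γ f s).comp (tangentPlane Γ s).starProjection = tangentialDeriv Γ f s := by
  ext1 v
  simp only [tangentialDeriv, ContinuousLinearMap.comp_apply]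
  rw [Submodule.starProjection_eq_self_iff.2 (Submodule.starProjection_apply_mem _ v)]

/-- Cyclicity of the trace. Traces on the varying tangent planes become traces on the fixed space
`E3`. -/
theorem trace_compression {T : Submodule ℝ E3} {A : E3 →L[ℝ] E3}
    (hA : A.comp T.starProjection = A) :
    LinearMap.trace ℝ T (T.orthogonalProjectionOnto.comp (A.comp T.subtypeL)).toLinearMap =
      LinearMap.trace ℝ E3 A.toLinearMap := by
  have h : A.toLinearMap =
      (A.comp T.subtypeL).toLinearMap ∘ₗ T.orthogonalProjectionOnto.toLinearMap := by
    conv_lhs => rw [← hA]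
    rfl
  rw [h, ← LinearMap.trace_comp_comm']
  rfl

theorem tangentialDiv_eq_trace (Γ : Set E3) (W : E3 → E3) (s : E3) :
    tangentialDiv Γ W s = LinearMap.trace ℝ E3 (tangentialDeriv Γ W s).toLinearMap := by
  rw [← trace_compression (tangentialDeriv_comp_starProjection Γ W s),
    LinearMap.trace_eq_sum_inner _ (stdOrthonormalBasis ℝ (tangentPlane Γ s))]
  refine Finset.sum_congr rfl fun i _ => ?_
  simp

/-- Symmetry makes the characteristic polynomial split over `ℝ`, so no eigenvalue is missing from
the multiset of real roots and their sum is the trace. -/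
theorem sum_principalCurvatures {Γ : Set E3} {n : E3 → E3} {s : E3}
    (h : (shapeOperator Γ n s).IsSymmetric) :
    (principalCurvatures Γ n s).sum = tangentialDiv Γ n s := by
  rw [principalCurvatures, ← Module.End.trace_eq_sum_roots_charpoly_of_splits h.splits_charpoly,
    tangentialDiv_eq_trace, ← trace_compression (tangentialDeriv_comp_starProjection Γ n s)]
  rfl

/-! ### Flattenings and local parametrizations of the surface. -/

/-- A local diffeomorphism of class `C²` that maps `Γ` to the plane `{t = 0}`, with image a ball
of `E2 × ℝ`. -/
structure IsFlattening (Γ : Set E3) (e : OpenPartialHomeomorph E3 (E2 × ℝ)) (r : ℝ) : Prop where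
  target_eq : e.target = Metric.ball 0 r
  contDiffOn : ContDiffOn ℝ 2 e e.source
  contDiffOn_symm : ContDiffOn ℝ 2 e.symm e.target
  mem_iff : ∀ x ∈ e.source, x ∈ Γ ↔ (e x).2 = 0

/-- Take for `T` the orthogonal projection onto the two-dimensional kernel of `A`. A vector of `ker
A` with zero projection onto it is zero. -/
theorem exists_injective_prod {A : E3 →L[ℝ] ℝ} (hA : A ≠ 0) :
    ∃ T : E3 →L[ℝ] E2, Function.Injective (T.prod A) := by
  have hrank : Module.finrank ℝ A.ker = 2 := by
    have h1 := A.toLinearMap.finrank_range_add_finrank_ker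
    have h2 : A.toLinearMap.range = ⊤ :=
      LinearMap.range_eq_top.2 (LinearMap.surjective (fun h => hA (by
        ext1 x; exact LinearMap.congr_fun h x)))
    rw [h2] at h1
    simp at h1
    have : Module.finrank ℝ A.toLinearMap.ker = 2 := by omega
    exact this
  let ι := (stdOrthonormalBasis ℝ A.ker).reindex (finCongr hrank)
  refine ⟨(ι.repr.toContinuousLinearEquiv : A.ker →L[ℝ] E2).comp
    A.ker.orthogonalProjectionOnto, (injective_iff_map_eq_zero _).2 fun x hx => ?_⟩
  simp only [ContinuousLinearMap.prod_apply, Prod.mk_eq_zero, ContinuousLinearMap.comp_apply] at hx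
  have h1 : A.ker.orthogonalProjectionOnto x = 0 := by simpa using hx.1
  have h2 : x ∈ A.ker := hx.2
  have h3 := Submodule.orthogonalProjectionOnto_mem_subspace_eq_self (⟨x, h2⟩ : A.ker)
  rw [show ((⟨x, h2⟩ : A.ker) : E3) = x from rfl, h1] at h3
  exact congrArg Subtype.val h3.symm

theorem exists_isFlattening {Γ : Set E3} (hΓ : IsSmoothSurface Γ) {p : E3} (hp : p ∈ Γ) :
    ∃ e r, IsFlattening Γ e r ∧ p ∈ e.source := by
  obtain ⟨U, F, hU, hpU, hF, hF', hΓU⟩ := hΓ p hp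
  obtain ⟨T, hT⟩ := exists_injective_prod (hF' p hpU)
  -- The defining function is the height coordinate and `T` supplies the two others, so the
  -- derivative at `p` is invertible and the inverse function theorem applies.
  let Ψ : E3 → E2 × ℝ := fun x => (T (x - p), F x)
  have hFU : ∀ x ∈ U, ContDiffAt ℝ 2 F x := fun x hx =>
    (hF.contDiffAt (hU.mem_nhds hx)).of_le
      (WithTop.coe_le_coe.2 le_top : ((2 : ℕ∞) : WithTop ℕ∞) ≤ ∞)
  have hΨ : ∀ x ∈ U, ContDiffAt ℝ 2 Ψ x := fun x hx =>
    ContDiffAt.prodMk (by fun_prop) (hFU x hx)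
  let L : E3 ≃L[ℝ] E2 × ℝ := (LinearMap.linearEquivOfInjective
    (T.prod (fderiv ℝ F p)).toLinearMap hT (by simp)).toContinuousLinearEquiv
  have hL : HasFDerivAt Ψ (L : E3 →L[ℝ] E2 × ℝ) p := by
    have h1 : HasFDerivAt (fun x => T (x - p)) T p :=
      T.hasFDerivAt.comp p ((hasFDerivAt_id p).sub_const p)
    have h2 : HasFDerivAt F (fderiv ℝ F p) p :=
      ((hFU p hpU).differentiableAt (by norm_num)).hasFDerivAt
    exact h1.prodMk h2
  have hΨp : Ψ p = 0 := by
    have : F p = 0 := by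
      have : p ∈ Γ ∩ U := ⟨hp, hpU⟩
      rw [hΓU] at this
      exact this.2
    simp [Ψ, this]
  let e₀ := (hΨ p hpU).toOpenPartialHomeomorph Ψ hL (by norm_num)
  have hps : p ∈ e₀.source := ContDiffAt.mem_toOpenPartialHomeomorph_source _ hL _
  have he₀p : e₀ p = 0 := hΨp
  have h0t : (0 : E2 × ℝ) ∈ e₀.target := he₀p ▸ e₀.map_source hps
  have hsymm0 : e₀.symm 0 = p := by rw [← he₀p, e₀.left_inv hps]
  have hsymm : ContDiffAt ℝ 2 e₀.symm 0 := by
    refine e₀.contDiffAt_symm h0t (f₀' := L) ?_ ?_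
    · rw [hsymm0]; exact hL
    · rw [hsymm0]; exact hΨ p hpU
  have hn : {y | ContDiffAt ℝ 2 e₀.symm y} ∩ (e₀.target ∩ e₀.symm ⁻¹' U) ∈ 𝓝 (0 : E2 × ℝ) := by
    refine inter_mem (hsymm.eventually (by norm_num)) (inter_mem (e₀.open_target.mem_nhds h0t) ?_)
    refine (e₀.continuousAt_symm h0t).preimage_mem_nhds ?_
    rw [hsymm0]
    exact hU.mem_nhds hpU
  obtain ⟨r, hr, hball⟩ := Metric.mem_nhds_iff.1 hn
  -- Restricting the inverse makes the target exactly a ball. Its slice `t = 0` and its half `t < 0`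
  -- are then convex, and their connectedness later fixes signs.
  let e := (e₀.symm.restrOpen (Metric.ball 0 r) Metric.isOpen_ball).symm
  have htgt : e.target = Metric.ball 0 r :=
    inter_eq_right.2 fun y hy => (hball hy).2.1
  have hsrc : ∀ x ∈ e.source, x ∈ U ∧ x ∈ e₀.source := by
    intro x hx
    have h1 : e x ∈ e.target := e.map_source hx
    rw [htgt] at h1
    have h2 : e.symm (e x) = x := e.left_inv hx
    have h3 : e₀.symm (e x) = x := h2
    refine ⟨by rw [← h3]; exact (hball h1).2.2, ?_⟩
    rw [← h3]
    exact e₀.map_target (hball h1).2.1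
  refine ⟨e, r, ⟨htgt, fun x hx => (hΨ x (hsrc x hx).1).contDiffWithinAt, ?_, ?_⟩, ?_⟩
  · intro y hy
    rw [htgt] at hy
    have h : ContDiffAt ℝ 2 e₀.symm y := (hball hy).1
    exact h.contDiffWithinAt
  · intro x hx
    have hxU := (hsrc x hx).1
    have : x ∈ Γ ∩ U ↔ F x = 0 := by
      rw [hΓU]
      exact ⟨fun h => h.2, fun h => ⟨hxU, h⟩⟩
    constructor
    · exact fun h => this.1 ⟨h, hxU⟩
    · exact fun h => (this.2 h).1
  · have : e.symm 0 ∈ e.source := e.map_target (by rw [htgt]; exact Metric.mem_ball_self hr)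
    have h2 : e.symm 0 = e₀.symm 0 := rfl
    rwa [h2, hsymm0] at this

/-- `φ` is a parametrization of class `C²` of the piece `Γ ∩ O` of the surface `Γ`, defined on the
connected open set `D`. -/
structure IsLocalParametrization (Γ O : Set E3) (D : Set E2) (φ : E2 → E3) : Prop where
  isOpen_target : IsOpen O
  isOpen : IsOpen D
  isPreconnected : IsPreconnected D
  contDiffOn : ContDiffOn ℝ 2 φ D
  image_eq : φ '' D = Γ ∩ O
  injective_fderiv : ∀ u ∈ D, Function.Injective (fderiv ℝ φ u)
  exists_leftInverse : ∃ ψ : E3 → E2, ContinuousOn ψ O ∧ ∀ u ∈ D, ψ (φ u) = u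

namespace IsFlattening

variable {Γ : Set E3} {e : OpenPartialHomeomorph E3 (E2 × ℝ)} {r : ℝ}

theorem mk_mem_target (h : IsFlattening Γ e r) {u : E2} (hu : u ∈ Metric.ball 0 r) :
    (u, (0 : ℝ)) ∈ e.target := by
  rw [h.target_eq]
  simpa [Prod.norm_def] using hu

theorem contDiffAt (h : IsFlattening Γ e r) {x : E3} (hx : x ∈ e.source) : ContDiffAt ℝ 2 e x :=
  h.contDiffOn.contDiffAt (e.open_source.mem_nhds hx)

theorem contDiffAt_symm (h : IsFlattening Γ e r) {y : E2 × ℝ} (hy : y ∈ e.target) :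
    ContDiffAt ℝ 2 e.symm y :=
  h.contDiffOn_symm.contDiffAt (e.open_target.mem_nhds hy)

theorem injective_fderiv_symm (h : IsFlattening Γ e r) {y : E2 × ℝ} (hy : y ∈ e.target) :
    Function.Injective (fderiv ℝ e.symm y) := by
  have h1 : HasFDerivAt e.symm (fderiv ℝ e.symm y) y :=
    ((h.contDiffAt_symm hy).differentiableAt (by norm_num)).hasFDerivAt
  have h2 : HasFDerivAt e (fderiv ℝ e (e.symm y)) (e.symm y) :=
    ((h.contDiffAt (e.map_target hy)).differentiableAt (by norm_num)).hasFDerivAt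
  have h3 : HasFDerivAt id ((fderiv ℝ e (e.symm y)).comp (fderiv ℝ e.symm y)) y :=
    (h2.comp y h1).congr_of_eventuallyEq (Filter.eventuallyEq_of_mem (e.open_target.mem_nhds hy)
      fun z hz => (e.right_inv hz).symm)
  have h4 := h3.unique (hasFDerivAt_id y)
  exact Function.LeftInverse.injective (g := fderiv ℝ e (e.symm y)) fun v =>
    DFunLike.congr_fun h4 v

theorem isLocalParametrization (h : IsFlattening Γ e r) :
    IsLocalParametrization Γ e.source (Metric.ball 0 r) fun u => e.symm (u, 0) where
  isOpen_target := e.open_source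
  isOpen := Metric.isOpen_ball
  isPreconnected := (convex_ball 0 r).isPreconnected
  contDiffOn := h.contDiffOn_symm.comp (t := e.target) (by fun_prop)
    fun u hu => h.mk_mem_target hu
  image_eq := by
    ext x
    constructor
    · rintro ⟨u, hu, rfl⟩
      have hs := e.map_target (h.mk_mem_target hu)
      exact ⟨(h.mem_iff _ hs).2 (by rw [e.right_inv (h.mk_mem_target hu)]), hs⟩
    · rintro ⟨hx, hs⟩
      have h0 := (h.mem_iff _ hs).1 hx
      have ht := e.map_source hs
      rw [h.target_eq] at ht
      have heq : ((e x).1, (0 : ℝ)) = e x := by rw [← h0]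
      refine ⟨(e x).1, ?_, ?_⟩
      · rw [mem_ball_zero_iff] at ht ⊢
        exact (norm_fst_le _).trans_lt ht
      · simp only [heq, e.left_inv hs]
  injective_fderiv := by
    intro u hu
    have h1 : HasFDerivAt (fun u : E2 => (u, (0 : ℝ))) (ContinuousLinearMap.inl ℝ E2 ℝ) u :=
      (hasFDerivAt_id u).prodMk (hasFDerivAt_const 0 u)
    have h2 : HasFDerivAt e.symm (fderiv ℝ e.symm (u, 0)) (u, 0) :=
      ((h.contDiffAt_symm (h.mk_mem_target hu)).differentiableAt (by norm_num)).hasFDerivAt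
    have h3 := (h2.comp u h1).fderiv
    simp only [Function.comp_def] at h3
    rw [h3]
    exact (h.injective_fderiv_symm (h.mk_mem_target hu)).comp fun a b hab => by
      simpa using hab
  exists_leftInverse := ⟨fun x => (e x).1, continuous_fst.comp_continuousOn e.continuousOn,
    fun u hu => by simp only [e.right_inv (h.mk_mem_target hu)]⟩

end IsFlattening

namespace IsLocalParametrization

variable {Γ O : Set E3} {D : Set E2} {φ : E2 → E3}

theorem mapsTo (h : IsLocalParametrization Γ O D φ) {u : E2} (hu : u ∈ D) : φ u ∈ Γ ∩ O :=
  h.image_eq ▸ mem_image_of_mem φ hu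

theorem contDiffAt (h : IsLocalParametrization Γ O D φ) {u : E2} (hu : u ∈ D) :
    ContDiffAt ℝ 2 φ u :=
  h.contDiffOn.contDiffAt (h.isOpen.mem_nhds hu)

theorem hasFDerivAt (h : IsLocalParametrization Γ O D φ) {u : E2} (hu : u ∈ D) :
    HasFDerivAt φ (fderiv ℝ φ u) u :=
  ((h.contDiffAt hu).differentiableAt (by norm_num)).hasFDerivAt

theorem injOn (h : IsLocalParametrization Γ O D φ) : InjOn φ D := by
  obtain ⟨ψ, -, hψ⟩ := h.exists_leftInverse
  intro u hu v hv huv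
  rw [← hψ u hu, huv, hψ v hv]

theorem fderiv_mem_tangentPlane (h : IsLocalParametrization Γ O D φ) {u : E2} (hu : u ∈ D)
    (v : E2) : fderiv ℝ φ u v ∈ tangentPlane Γ (φ u) := by
  refine Submodule.subset_span ?_
  have h1 := (h.hasFDerivAt hu).hasFDerivWithinAt.mapsTo_tangent_cone (s := D)
    (show v ∈ tangentConeAt ℝ D u by
      rw [tangentConeAt_of_mem_nhds (h.isOpen.mem_nhds hu)]; trivial)
  refine tangentConeAt_mono ?_ h1
  rw [h.image_eq]
  exact inter_subset_left

/-- The range of `Dφ` lies in the tangent plane, which lies in `νᗮ`. Both ends have dimension two.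
-/
theorem range_fderiv_eq (h : IsLocalParametrization Γ O D φ) {u : E2} (hu : u ∈ D) {ν : E3}
    (hν : ‖ν‖ = 1) (hνT : ν ∈ (tangentPlane Γ (φ u))ᗮ) :
    (fderiv ℝ φ u).toLinearMap.range = tangentPlane Γ (φ u) ∧
      tangentPlane Γ (φ u) = (ℝ ∙ ν)ᗮ := by
  have h1 : (fderiv ℝ φ u).toLinearMap.range ≤ tangentPlane Γ (φ u) := by
    rintro _ ⟨v, rfl⟩
    exact h.fderiv_mem_tangentPlane hu v
  have h2 : tangentPlane Γ (φ u) ≤ (ℝ ∙ ν)ᗮ := by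
    rw [Submodule.le_orthogonal_iff_le_orthogonal, Submodule.span_singleton_le_iff_mem]
    exact hνT
  have h3 : Module.finrank ℝ (fderiv ℝ φ u).toLinearMap.range = 2 := by
    rw [LinearMap.finrank_range_of_inj (h.injective_fderiv u hu)]
    simp
  have hν0 : ν ≠ 0 := fun h0 => by simp [h0] at hν
  have h4 : Module.finrank ℝ (ℝ ∙ ν)ᗮ = 2 := by
    have := (ℝ ∙ ν).finrank_add_finrank_orthogonal
    rw [finrank_span_singleton hν0] at this
    simp at this
    omega
  have h5 := Submodule.eq_of_le_of_finrank_eq (h1.trans h2) (h3.trans h4.symm)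
  exact ⟨le_antisymm h1 (h5 ▸ h2), le_antisymm h2 (h5 ▸ h1)⟩

/-- The chain rule along the surface. -/
theorem fderiv_comp_apply (h : IsLocalParametrization Γ O D φ) {u : E2} (hu : u ∈ D) {f : E3 → E3}
    (hf : DifferentiableWithinAt ℝ f Γ (φ u)) (v : E2) :
    fderiv ℝ (fun w => f (φ w)) u v = tangentialDeriv Γ f (φ u) (fderiv ℝ φ u v) := by
  have h1 : HasFDerivWithinAt (f ∘ φ) _ D u :=
    hf.hasFDerivWithinAt.comp u (h.hasFDerivAt hu).hasFDerivWithinAt fun w hw => (h.mapsTo hw).1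
  have h2 := (h1.hasFDerivAt (h.isOpen.mem_nhds hu)).fderiv
  simp only [Function.comp_def] at h2
  rw [h2]
  simp only [tangentialDeriv, ContinuousLinearMap.comp_apply]
  rw [Submodule.starProjection_eq_self_iff.2 (h.fderiv_mem_tangentPlane hu v)]

end IsLocalParametrization

theorem exists_isLocalParametrization {Γ : Set E3} (hΓ : IsSmoothSurface Γ) {p : E3} (hp : p ∈ Γ) :
    ∃ O D φ, IsLocalParametrization Γ O D φ ∧ p ∈ O := by
  obtain ⟨e, r, h, hpe⟩ := exists_isFlattening hΓ hp
  exact ⟨_, _, _, h.isLocalParametrization, hpe⟩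

namespace IsLocalParametrization

variable {Ω O : Set E3} {D : Set E2} {φ : E2 → E3} {n : E3 → E3}

theorem inner_normal_fderiv (h : IsLocalParametrization (frontier Ω) O D φ)
    (hn : IsOuterUnitNormal Ω n) {u : E2} (hu : u ∈ D) (v : E2) :
    ⟪n (φ u), fderiv ℝ φ u v⟫ = 0 := by
  rw [real_inner_comm]
  exact Submodule.inner_right_of_mem_orthogonal (h.fderiv_mem_tangentPlane hu v)
    (hn _ (h.mapsTo hu).1).2.1

end IsLocalParametrization

/-! ### Orientation and regularity of the outer normal. -/

theorem tangentPlane_eq_orthogonal {Ω : Set E3} (hΓ : IsSmoothSurface (frontier Ω)) {n : E3 → E3}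
    (hn : IsOuterUnitNormal Ω n) {s : E3} (hs : s ∈ frontier Ω) :
    tangentPlane (frontier Ω) s = (ℝ ∙ n s)ᗮ := by
  obtain ⟨O, D, φ, h, hsO⟩ := exists_isLocalParametrization hΓ hs
  have : s ∈ φ '' D := h.image_eq ▸ ⟨hs, hsO⟩
  obtain ⟨u, hu, rfl⟩ := this
  exact (h.range_fderiv_eq hu (hn _ hs).1 (hn _ hs).2.1).2

theorem starProjection_tangentPlane {Ω : Set E3} (hΓ : IsSmoothSurface (frontier Ω)) {n : E3 → E3}
    (hn : IsOuterUnitNormal Ω n) {s : E3} (hs : s ∈ frontier Ω) (v : E3) :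
    (tangentPlane (frontier Ω) s).starProjection v = v - ⟪n s, v⟫ • n s := by
  rw [tangentPlane_eq_orthogonal hΓ hn hs, Submodule.starProjection_orthogonal_val,
    Submodule.starProjection_unit_singleton ℝ (hn s hs).1]

theorem IsPreconnected.subset_of_disjoint_frontier {X : Type*} [TopologicalSpace X] {S Ω : Set X}
    (hS : IsPreconnected S) (hΩ : IsOpen Ω) (hd : Disjoint S (frontier Ω)) {x y : X} (hx : x ∈ S)
    (hxΩ : x ∈ Ω) (hy : y ∈ S) : y ∈ Ω := by
  have hcov : S ⊆ Ω ∪ (closure Ω)ᶜ := fun z hz => by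
    by_contra hcon
    simp only [mem_union, mem_compl_iff, not_or, not_not] at hcon
    refine disjoint_left.1 hd hz ?_
    rw [hΩ.frontier_eq]
    exact ⟨hcon.2, hcon.1⟩
  by_contra hyΩ
  obtain ⟨z, -, hz1, hz2⟩ := hS Ω (closure Ω)ᶜ hΩ isClosed_closure.isOpen_compl hcov ⟨x, hx, hxΩ⟩
    ⟨y, hy, (hcov hy).resolve_left hyΩ⟩
  exact hz2 (subset_closure hz1)

theorem HasDerivAt.eventually_neg {φ : ℝ → ℝ} {c : ℝ} (h : HasDerivAt φ c 0) (h0 : φ 0 = 0)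
    (hc : c < 0) : ∀ᶠ t in 𝓝[>] 0, φ t < 0 := by
  have h1 := (hasDerivWithinAt_iff_tendsto_slope' (s := Ioi (0 : ℝ)) (by simp)).1
    (h.hasDerivWithinAt (s := Ioi 0))
  filter_upwards [h1.eventually_lt_const hc, self_mem_nhdsWithin] with t ht htpos
  rw [slope_def_field, h0, sub_zero, sub_zero] at ht
  by_contra hcon
  exact absurd ht (not_lt.2 (div_nonneg (not_lt.1 hcon) (le_of_lt htpos)))

namespace IsFlattening

variable {Ω : Set E3} {e : OpenPartialHomeomorph E3 (E2 × ℝ)} {r : ℝ} {n : E3 → E3}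

theorem contDiffAt_snd (h : IsFlattening (frontier Ω) e r) {s : E3} (hs : s ∈ e.source) :
    ContDiffAt ℝ 2 (fun x => (e x).2) s :=
  _root_.contDiffAt_snd.comp s (h.contDiffAt hs)

theorem hasFDerivAt_snd (h : IsFlattening (frontier Ω) e r) {s : E3} (hs : s ∈ e.source) :
    HasFDerivAt (fun x => (e x).2) (fderiv ℝ (fun x => (e x).2) s) s :=
  ((h.contDiffAt_snd hs).differentiableAt (by norm_num)).hasFDerivAt

/-- The height function vanishes on the surface, so its derivative kills the tangent plane and sees
only the normal component of `v`. -/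
theorem fderiv_snd_eq (h : IsFlattening (frontier Ω) e r) (hΓ : IsSmoothSurface (frontier Ω))
    (hn : IsOuterUnitNormal Ω n) {s : E3} (hsΓ : s ∈ frontier Ω) (hs : s ∈ e.source) (v : E3) :
    fderiv ℝ (fun x => (e x).2) s v = fderiv ℝ (fun x => (e x).2) s (n s) * ⟪n s, v⟫ := by
  have h1 : HasFDerivWithinAt (fun x => (e x).2) (fderiv ℝ (fun x => (e x).2) s) (frontier Ω) s :=
    (h.hasFDerivAt_snd hs).hasFDerivWithinAt
  have h2 : HasFDerivWithinAt (fun x => (e x).2) (0 : E3 →L[ℝ] ℝ) (frontier Ω) s := by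
    refine (hasFDerivWithinAt_const (0 : ℝ) s (frontier Ω)).congr_of_eventuallyEq ?_
      ((h.mem_iff s hs).1 hsΓ)
    filter_upwards [self_mem_nhdsWithin, mem_nhdsWithin_of_mem_nhds (e.open_source.mem_nhds hs)]
      with x hx hxs
    exact (h.mem_iff x hxs).1 hx
  have key : ∀ w ∈ tangentPlane (frontier Ω) s, fderiv ℝ (fun x => (e x).2) s w = 0 := fun w hw =>
    LinearMap.eqOn_span (f := (fderiv ℝ (fun x => (e x).2) s).toLinearMap)
      (g := (0 : E3 →L[ℝ] ℝ).toLinearMap) (fun w hw => HasFDerivWithinAt.unique_on h1 h2 hw) hw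
  have h3 := key _ (Submodule.starProjection_apply_mem (tangentPlane (frontier Ω) s) v)
  rw [starProjection_tangentPlane hΓ hn hsΓ, map_sub, map_smul, sub_eq_zero, smul_eq_mul] at h3
  rw [h3, mul_comm]

theorem fderiv_snd_normal_ne_zero (h : IsFlattening (frontier Ω) e r)
    (hΓ : IsSmoothSurface (frontier Ω)) (hn : IsOuterUnitNormal Ω n) {s : E3}
    (hsΓ : s ∈ frontier Ω) (hs : s ∈ e.source) : fderiv ℝ (fun x => (e x).2) s (n s) ≠ 0 := by
  intro h0
  have ht := e.map_source hs
  have h1 : HasFDerivAt e.symm (fderiv ℝ e.symm (e s)) (e s) :=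
    ((h.contDiffAt_symm ht).differentiableAt (by norm_num)).hasFDerivAt
  have h2 := h.hasFDerivAt_snd hs
  rw [← e.left_inv hs] at h2
  have h3 : HasFDerivAt (fun y : E2 × ℝ => y.2) _ (e s) :=
    (h2.comp (e s) h1).congr_of_eventuallyEq (Filter.eventuallyEq_of_mem
      (e.open_target.mem_nhds ht) fun z hz => by simp [e.right_inv hz])
  have h4 := DFunLike.congr_fun (h3.unique _root_.hasFDerivAt_snd) (0, 1)
  rw [ContinuousLinearMap.comp_apply, e.left_inv hs, h.fderiv_snd_eq hΓ hn hsΓ hs, h0] at h4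
  simp at h4

theorem hasDerivAt_snd_line (h : IsFlattening (frontier Ω) e r) {s : E3} (hs : s ∈ e.source)
    (w : E3) : HasDerivAt (fun t : ℝ => (e (s + t • w)).2)
      (fderiv ℝ (fun x => (e x).2) s w) 0 := by
  have h1 : HasDerivAt (fun t : ℝ => s + t • w) w 0 := by
    simpa using ((hasDerivAt_id (0 : ℝ)).smul_const w).const_add s
  have h2 : HasFDerivAt (fun x => (e x).2) (fderiv ℝ (fun x => (e x).2) s) (s + (0 : ℝ) • w) := by
    simpa using h.hasFDerivAt_snd hs
  exact h2.comp_hasDerivAt (0 : ℝ) h1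

theorem eventually_line (h : IsFlattening (frontier Ω) e r) {s : E3} (hsΓ : s ∈ frontier Ω)
    (hs : s ∈ e.source) {w : E3} (hw : fderiv ℝ (fun x => (e x).2) s w < 0) :
    ∀ᶠ t : ℝ in 𝓝[>] 0, s + t • w ∈ e.source ∧ (e (s + t • w)).2 < 0 := by
  have hc : ContinuousAt (fun t : ℝ => s + t • w) 0 := by fun_prop
  have h1 : ∀ᶠ t : ℝ in 𝓝 0, s + t • w ∈ e.source :=
    hc.preimage_mem_nhds (e.open_source.mem_nhds (by simpa using hs))
  have h2 := (h.hasDerivAt_snd_line hs w).eventually_neg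
    (by simpa using (h.mem_iff s hs).1 hsΓ) hw
  exact (h1.filter_mono nhdsWithin_le_nhds).and h2

/-- The outer normal points to the same side of the flattened surface at all points of a chart. -/
theorem fderiv_snd_normal_neg (h : IsFlattening (frontier Ω) e r) (hΩ : IsOpen Ω)
    (hn : IsOuterUnitNormal Ω n) {s s' : E3} (hsΓ : s ∈ frontier Ω) (hs : s ∈ e.source)
    (hsΓ' : s' ∈ frontier Ω) (hs' : s' ∈ e.source)
    (hneg : fderiv ℝ (fun x => (e x).2) s (n s) < 0) :
    ¬ 0 < fderiv ℝ (fun x => (e x).2) s' (n s') := by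
  intro hpos
  -- The part of the chart with negative height is connected and misses `frontier Ω`. If the normal
  -- pointed down at `s` and up at `s'`, this part would contain a point just outside near `s` and
  -- one just inside near `s'`.
  have hlow : IsPreconnected (e.symm '' (Metric.ball 0 r ∩ {q | q.2 < 0})) := by
    refine (((convex_ball (0 : E2 × ℝ) r).inter ?_).isPreconnected).image _
      (e.symm.continuousOn.mono ?_)
    · exact (convex_Iio (0 : ℝ)).linear_preimage (LinearMap.snd ℝ E2 ℝ)
    · exact fun q hq => by
        have : q ∈ e.target := h.target_eq ▸ hq.1
        exact this
  have hmem : ∀ x ∈ e.source, (e x).2 < 0 → x ∈ e.symm '' (Metric.ball 0 r ∩ {q | q.2 < 0}) :=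
    fun x hx hx2 => ⟨e x, ⟨h.target_eq ▸ e.map_source hx, hx2⟩, e.left_inv hx⟩
  have hdisj : Disjoint (e.symm '' (Metric.ball 0 r ∩ {q | q.2 < 0})) (frontier Ω) := by
    refine disjoint_left.2 ?_
    rintro _ ⟨q, ⟨hq1, hq2⟩, rfl⟩ hf
    have hq : q ∈ e.target := h.target_eq ▸ hq1
    have := (h.mem_iff _ (e.map_target hq)).1 hf
    rw [e.right_inv hq] at this
    exact absurd this (ne_of_lt hq2)
  obtain ⟨t, ⟨ht1, ht2⟩, ht3⟩ := ((h.eventually_line hsΓ hs hneg).and (hn s hsΓ).2.2).exists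
  have hpos' : fderiv ℝ (fun x => (e x).2) s' (-n s') < 0 := by
    rw [map_neg]
    linarith
  obtain ⟨t', ⟨ht1', ht2'⟩, ht3'⟩ :=
    ((h.eventually_line hsΓ' hs' hpos').and (hn s' hsΓ').2.2).exists
  have hin : s' + t' • -n s' ∈ Ω := by
    rw [smul_neg, ← sub_eq_add_neg]
    exact ht3'.1
  have := hlow.subset_of_disjoint_frontier hΩ hdisj (hmem _ ht1' ht2') hin (hmem _ ht1 ht2)
  exact ht3.2 (subset_closure this)

/-- The normal is the normalised gradient of the height up to a sign, and `fderiv_snd_normal_neg`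
makes this sign `σ = ±1` the same on the whole chart. The right-hand side extends `n` off the
surface, which gives its regularity. -/
theorem exists_normal_eq (h : IsFlattening (frontier Ω) e r) (hΩ : IsOpen Ω)
    (hΓ : IsSmoothSurface (frontier Ω)) (hn : IsOuterUnitNormal Ω n) :
    ∃ σ : ℝ, ∀ s ∈ frontier Ω, s ∈ e.source →
      n s = (σ * ‖gradient (fun x => (e x).2) s‖⁻¹) • gradient (fun x => (e x).2) s := by
  have hgrad : ∀ s ∈ frontier Ω, s ∈ e.source → gradient (fun x => (e x).2) s =
      fderiv ℝ (fun x => (e x).2) s (n s) • n s := fun s hsΓ hs => by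
    refine ext_inner_right ℝ fun v => ?_
    rw [gradient, InnerProductSpace.toDual_symm_apply, h.fderiv_snd_eq hΓ hn hsΓ hs v,
      real_inner_smul_left]
  have hform : ∀ σ : ℝ, |σ| = 1 → (∀ s ∈ frontier Ω, s ∈ e.source →
      |fderiv ℝ (fun x => (e x).2) s (n s)| = σ * fderiv ℝ (fun x => (e x).2) s (n s)) →
      ∀ s ∈ frontier Ω, s ∈ e.source →
      n s = (σ * ‖gradient (fun x => (e x).2) s‖⁻¹) • gradient (fun x => (e x).2) s := by
    intro σ hσ1 hσ s hsΓ hs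
    have hne := h.fderiv_snd_normal_ne_zero hΓ hn hsΓ hs
    rw [hgrad s hsΓ hs, norm_smul, (hn s hsΓ).1, mul_one, Real.norm_eq_abs, smul_smul,
      mul_right_comm, ← hσ s hsΓ hs, mul_inv_cancel₀ (abs_ne_zero.2 hne), one_smul]
  by_cases hneg : ∃ s ∈ frontier Ω, s ∈ e.source ∧ fderiv ℝ (fun x => (e x).2) s (n s) < 0
  · obtain ⟨s, hsΓ, hs, hlt⟩ := hneg
    refine ⟨-1, hform (-1) (by simp) fun s' hsΓ' hs' => ?_⟩
    rw [abs_of_nonpos (not_lt.1 (h.fderiv_snd_normal_neg hΩ hn hsΓ hs hsΓ' hs' hlt))]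
    ring
  · push Not at hneg
    refine ⟨1, hform 1 (by simp) fun s hsΓ hs => ?_⟩
    rw [abs_of_nonneg (hneg s hsΓ hs), one_mul]

end IsFlattening

theorem contDiffOn_outerUnitNormal {Ω : Set E3} {n : E3 → E3} (hn : IsOuterUnitNormal Ω n)
    (hΩ : IsOpen Ω) (hΓ : IsSmoothSurface (frontier Ω)) : ContDiffOn ℝ 1 n (frontier Ω) := by
  intro s hsΓ
  obtain ⟨e, r, h, hs⟩ := exists_isFlattening hΓ hsΓ
  obtain ⟨σ, hσ⟩ := h.exists_normal_eq hΩ hΓ hn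
  have hG : ContDiffAt ℝ 1 (gradient fun x => (e x).2) s := by
    have h1 : ContDiffAt ℝ 1 (fderiv ℝ fun x => (e x).2) s :=
      (h.contDiffAt_snd hs).fderiv_right (by norm_num)
    exact (InnerProductSpace.toDual ℝ E3).symm.toContinuousLinearEquiv.contDiff.contDiffAt.comp s h1
  have hG0 : gradient (fun x => (e x).2) s ≠ 0 := fun h0 => by
    have h1 := hσ s hsΓ hs
    rw [h0, smul_zero] at h1
    have := (hn s hsΓ).1
    rw [h1] at this
    simp at this
  have h2 : ContDiffAt ℝ 1 (fun s => (σ * ‖gradient (fun x => (e x).2) s‖⁻¹) •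
      gradient (fun x => (e x).2) s) s :=
    (contDiffAt_const.mul ((hG.norm ℝ hG0).inv (norm_ne_zero_iff.2 hG0))).smul hG
  refine h2.contDiffWithinAt.congr_of_eventuallyEq ?_ (hσ s hsΓ hs)
  filter_upwards [self_mem_nhdsWithin, mem_nhdsWithin_of_mem_nhds (e.open_source.mem_nhds hs)]
    with x hx hxs
  exact hσ x hx hxs

/-- Cramer's rule for `n` in terms of `x, y, z`, paired with `n`. -/
theorem tripleProduct_mul_inner_self (x y z n : E3) :
    tripleProduct x y z * ⟪n, n⟫ = ⟪n, x⟫ * tripleProduct n y z + ⟪n, y⟫ * tripleProduct x n z +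
      ⟪n, z⟫ * tripleProduct x y n := by
  simp only [tripleProduct, inner_eq_coord]
  ring

theorem tripleProduct_eq_neg_inner_mul (x y z n : E3) (hn : ‖n‖ = 1) (hy : ⟪n, y⟫ = 0)
    (hz : ⟪n, z⟫ = 0) : tripleProduct x y z = -(⟪n, x⟫ * tripleProduct z y n) := by
  have h := tripleProduct_mul_inner_self x y z n
  rw [hy, hz, real_inner_self_eq_norm_sq, hn] at h
  have h2 : tripleProduct n y z = -tripleProduct z y n := by simp only [tripleProduct]; ring
  rw [h2] at h
  linarith

theorem tripleProduct_swap (x y z : E3) : tripleProduct x y z = -tripleProduct y x z := by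
  simp only [tripleProduct]
  ring

theorem tangentialDeriv_congr {Γ : Set E3} {f g : E3 → E3} {s : E3} (h : f =ᶠ[𝓝[Γ] s] g)
    (hs : f s = g s) : tangentialDeriv Γ f s = tangentialDeriv Γ g s := by
  unfold tangentialDeriv
  rw [h.fderivWithin_eq hs]

theorem tangentialDeriv_smul {Γ : Set E3} {v : E3 → ℝ} {f : E3 → E3} {s : E3}
    (hv : DifferentiableWithinAt ℝ v Γ s) (hf : DifferentiableWithinAt ℝ f Γ s) :
    tangentialDeriv Γ (fun x => v x • f x) s = v s • tangentialDeriv Γ f s +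
      ((fderivWithin ℝ v Γ s).comp (tangentPlane Γ s).starProjection).smulRight (f s) := by
  have h : HasFDerivWithinAt (fun x => v x • f x) _ Γ s :=
    hv.hasFDerivWithinAt.smul hf.hasFDerivWithinAt
  rw [tangentialDeriv_eq h, tangentialDeriv_eq hf.hasFDerivWithinAt]
  ext1 w
  simp

theorem tangentialDiv_smul {Γ : Set E3} {v : E3 → ℝ} {f : E3 → E3} {s : E3}
    (hv : DifferentiableWithinAt ℝ v Γ s) (hf : DifferentiableWithinAt ℝ f Γ s) :
    tangentialDiv Γ (fun x => v x • f x) s = v s * tangentialDiv Γ f s +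
      fderivWithin ℝ v Γ s ((tangentPlane Γ s).starProjection (f s)) := by
  rw [tangentialDiv_eq_trace, tangentialDiv_eq_trace, tangentialDeriv_smul hv hf]
  simp only [ContinuousLinearMap.toLinearMap_add, ContinuousLinearMap.toLinearMap_smul,
    map_add, map_smul, smul_eq_mul]
  congr 1
  exact LinearMap.trace_smulRight ((fderivWithin ℝ v Γ s).comp
    (tangentPlane Γ s).starProjection).toLinearMap (f s)

theorem tangentialDeriv_sum {ι : Type*} {Γ : Set E3} {t : Finset ι} {f : ι → E3 → E3} {s : E3}
    (hf : ∀ i ∈ t, DifferentiableWithinAt ℝ (f i) Γ s) :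
    tangentialDeriv Γ (fun x => ∑ i ∈ t, f i x) s = ∑ i ∈ t, tangentialDeriv Γ (f i) s := by
  rw [tangentialDeriv_eq (HasFDerivWithinAt.fun_sum fun i hi => (hf i hi).hasFDerivWithinAt)]
  ext1 w
  simp [tangentialDeriv]

/-- `fderivWithin` is a choice of derivative and need not vary continuously. The `C¹` hypothesis
gives a continuous choice locally, and both agree after projection to the tangent plane. -/
theorem continuousOn_tangentialDeriv {Γ : Set E3}
    (hP : ContinuousOn (fun s => (tangentPlane Γ s).starProjection) Γ) {f : E3 → E3}
    (hf : ContDiffOn ℝ 1 f Γ) : ContinuousOn (tangentialDeriv Γ f) Γ := by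
  intro s hs
  have h1 : ContDiffWithinAt ℝ (0 + 1) f Γ s := by simpa using hf s hs
  obtain ⟨u, hu, -, -, f', hf', hc⟩ :=
    (contDiffWithinAt_succ_iff_hasFDerivWithinAt' (by norm_num)).1 h1
  rw [insert_eq_of_mem hs] at hu
  have h2 : ContinuousWithinAt (fun x => (f' x).comp (tangentPlane Γ x).starProjection) Γ s :=
    hc.continuousWithinAt.clm_comp (hP s hs)
  refine h2.congr_of_eventuallyEq ?_ (tangentialDeriv_eq (hf' s (mem_of_mem_nhdsWithin hs hu)))
  filter_upwards [hu] with x hx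
  exact tangentialDeriv_eq (hf' x hx)

theorem continuousOn_tangentialDiv {Γ : Set E3}
    (hP : ContinuousOn (fun s => (tangentPlane Γ s).starProjection) Γ) {f : E3 → E3}
    (hf : ContDiffOn ℝ 1 f Γ) : ContinuousOn (tangentialDiv Γ f) Γ := by
  have h := continuousOn_tangentialDeriv hP hf
  have h2 : ∀ (w : E3) (i : Fin 3), ContinuousOn (fun s => tangentialDeriv Γ f s w i) Γ :=
    fun w i => (EuclideanSpace.proj i : E3 →L[ℝ] ℝ).continuous.comp_continuousOn
      (h.clm_apply continuousOn_const)
  refine ContinuousOn.congr (((h2 (EuclideanSpace.single 0 1) 0).add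
    (h2 (EuclideanSpace.single 1 1) 1)).add (h2 (EuclideanSpace.single 2 1) 2)) fun s _ => ?_
  rw [tangentialDiv_eq_trace, trace_eq_sum_coord]
  rfl

/-! ### Derivatives of the normal and symmetry of the shape operator. -/

section OuterNormal

variable {Ω : Set E3} {n : E3 → E3}

theorem continuousOn_starProjection_tangentPlane (hΩ : IsOpen Ω)
    (hΓ : IsSmoothSurface (frontier Ω)) (hn : IsOuterUnitNormal Ω n) :
    ContinuousOn (fun s => (tangentPlane (frontier Ω) s).starProjection) (frontier Ω) := by
  have hc := (contDiffOn_outerUnitNormal hn hΩ hΓ).continuousOn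
  have h : ContinuousOn (fun s => ContinuousLinearMap.id ℝ E3 -
      (innerSL ℝ (n s)).smulRight (n s)) (frontier Ω) := by
    refine continuousOn_const.sub ?_
    have h2 : Continuous fun p : E3 => (innerSL ℝ p).smulRight p := by
      have : Continuous fun p : E3 => (ContinuousLinearMap.smulRightL ℝ E3 E3 (innerSL ℝ p)) p := by
        fun_prop
      exact this
    exact h2.comp_continuousOn hc
  refine h.congr fun s hs => ?_
  ext1 v
  rw [starProjection_tangentPlane hΓ hn hs]
  simp

theorem tangentialDeriv_normal_eq_zero (hn : IsOuterUnitNormal Ω n) {s : E3}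
    (hs : s ∈ frontier Ω) (f : E3 → E3) : tangentialDeriv (frontier Ω) f s (n s) = 0 := by
  simp only [tangentialDeriv, ContinuousLinearMap.comp_apply]
  rw [(Submodule.starProjection_apply_eq_zero_iff _).2 (hn s hs).2.1, map_zero]

namespace IsLocalParametrization

variable {O : Set E3} {D : Set E2} {φ : E2 → E3}

theorem contDiffOn_comp {Γ : Set E3} (h : IsLocalParametrization Γ O D φ) {f : E3 → E3}
    (hf : ContDiffOn ℝ 1 f Γ) : ContDiffOn ℝ 1 (fun u => f (φ u)) D :=
  hf.comp (h.contDiffOn.of_le (by norm_num)) fun _ hu => (h.mapsTo hu).1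

theorem differentiableAt_comp {Γ : Set E3} (h : IsLocalParametrization Γ O D φ) {f : E3 → E3}
    (hf : ContDiffOn ℝ 1 f Γ) {u : E2} (hu : u ∈ D) : DifferentiableAt ℝ (fun u => f (φ u)) u :=
  ((h.contDiffOn_comp hf).contDiffAt (h.isOpen.mem_nhds hu)).differentiableAt (by norm_num)

theorem contDiffOn_fderiv_apply {Γ : Set E3} (h : IsLocalParametrization Γ O D φ) (v : E2) :
    ContDiffOn ℝ 1 (fun u => fderiv ℝ φ u v) D :=
  (h.contDiffOn.fderiv_of_isOpen h.isOpen (by norm_num)).clm_apply contDiffOn_const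

theorem differentiableAt_fderiv {Γ : Set E3} (h : IsLocalParametrization Γ O D φ) {u : E2}
    (hu : u ∈ D) : DifferentiableAt ℝ (fderiv ℝ φ) u :=
  (((h.contDiffOn.fderiv_of_isOpen (m := 1) h.isOpen (by norm_num))).contDiffAt
    (h.isOpen.mem_nhds hu)).differentiableAt (by norm_num)

theorem fderiv_fderiv_apply {Γ : Set E3} (h : IsLocalParametrization Γ O D φ) {u : E2}
    (hu : u ∈ D) (v w : E2) :
    fderiv ℝ (fun x => fderiv ℝ φ x v) u w = fderiv ℝ (fderiv ℝ φ) u w v := by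
  rw [fderiv_clm_apply (h.differentiableAt_fderiv hu) (differentiableAt_const v)]
  simp

theorem fderiv_fderiv_comm {Γ : Set E3} (h : IsLocalParametrization Γ O D φ) {u : E2}
    (hu : u ∈ D) (v w : E2) :
    fderiv ℝ (fderiv ℝ φ) u v w = fderiv ℝ (fderiv ℝ φ) u w v :=
  (h.contDiffAt hu).isSymmSndFDerivAt (by simp) v w

theorem inner_fderiv_normal (h : IsLocalParametrization (frontier Ω) O D φ) (hΩ : IsOpen Ω)
    (hΓ : IsSmoothSurface (frontier Ω)) (hn : IsOuterUnitNormal Ω n) {u : E2} (hu : u ∈ D)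
    (v : E2) : ⟪n (φ u), fderiv ℝ (fun x => n (φ x)) u v⟫ = 0 := by
  have hd := h.differentiableAt_comp (contDiffOn_outerUnitNormal hn hΩ hΓ) hu
  have h1 : (fun x => ⟪n (φ x), n (φ x)⟫) =ᶠ[𝓝 u] fun _ => (1 : ℝ) :=
    Filter.eventuallyEq_of_mem (h.isOpen.mem_nhds hu) fun x hx => by
      simp only [real_inner_self_eq_norm_sq, (hn _ (h.mapsTo hx).1).1, one_pow]
  have h2 := congrArg (fun L : E2 →L[ℝ] ℝ => L v) h1.fderiv_eq
  simp only [fderiv_inner_apply ℝ hd hd] at h2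
  rw [real_inner_comm] at h2
  simp at h2
  rw [real_inner_comm] at h2
  linarith

/-- Differentiate `⟪n, Dφ w⟫ = 0` in the direction `v`. Symmetry of the second derivative of `φ`
then yields symmetry of the shape operator. -/
theorem inner_fderiv_normal_fderiv (h : IsLocalParametrization (frontier Ω) O D φ)
    (hΩ : IsOpen Ω) (hΓ : IsSmoothSurface (frontier Ω)) (hn : IsOuterUnitNormal Ω n) {u : E2}
    (hu : u ∈ D) (v w : E2) : ⟪fderiv ℝ (fun x => n (φ x)) u v, fderiv ℝ φ u w⟫ =
      -⟪n (φ u), fderiv ℝ (fderiv ℝ φ) u v w⟫ := by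
  have hd := h.differentiableAt_comp (contDiffOn_outerUnitNormal hn hΩ hΓ) hu
  have hd2 : DifferentiableAt ℝ (fun x => fderiv ℝ φ x w) u :=
    (h.differentiableAt_fderiv hu).clm_apply (differentiableAt_const w)
  have h1 : (fun x => ⟪n (φ x), fderiv ℝ φ x w⟫) =ᶠ[𝓝 u] fun _ => (0 : ℝ) :=
    Filter.eventuallyEq_of_mem (h.isOpen.mem_nhds hu) fun x hx => h.inner_normal_fderiv hn hx w
  have h2 := congrArg (fun L : E2 →L[ℝ] ℝ => L v) h1.fderiv_eq
  simp only [fderiv_inner_apply ℝ hd hd2, h.fderiv_fderiv_apply hu] at h2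
  simp at h2
  linarith

end IsLocalParametrization

theorem isSymmetric_shapeOperator (hΩ : IsOpen Ω) (hΓ : IsSmoothSurface (frontier Ω))
    (hn : IsOuterUnitNormal Ω n) {s : E3} (hs : s ∈ frontier Ω) :
    (shapeOperator (frontier Ω) n s).IsSymmetric := by
  obtain ⟨O, D, φ, h, hsO⟩ := exists_isLocalParametrization hΓ hs
  have : s ∈ φ '' D := h.image_eq ▸ ⟨hs, hsO⟩
  obtain ⟨u, hu, rfl⟩ := this
  have hr := (h.range_fderiv_eq hu (hn _ hs).1 (hn _ hs).2.1).1
  have hd : DifferentiableWithinAt ℝ n (frontier Ω) (φ u) :=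
    (contDiffOn_outerUnitNormal hn hΩ hΓ).differentiableOn one_ne_zero _ hs
  have key : ∀ x y : tangentPlane (frontier Ω) (φ u), ∃ v w, (x : E3) = fderiv ℝ φ u v ∧
      (y : E3) = fderiv ℝ φ u w ∧ ⟪shapeOperator (frontier Ω) n (φ u) x, y⟫ =
        -⟪n (φ u), fderiv ℝ (fderiv ℝ φ) u v w⟫ := by
    intro x y
    obtain ⟨v, hv⟩ : (x : E3) ∈ (fderiv ℝ φ u).toLinearMap.range := by
      rw [hr]; exact x.2
    obtain ⟨w, hw⟩ : (y : E3) ∈ (fderiv ℝ φ u).toLinearMap.range := by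
      rw [hr]; exact y.2
    refine ⟨v, w, hv.symm, hw.symm, ?_⟩
    rw [← h.inner_fderiv_normal_fderiv hΩ hΓ hn hu, h.fderiv_comp_apply hu hd]
    have hv' : fderiv ℝ φ u v = x := hv
    have hw' : fderiv ℝ φ u w = y := hw
    rw [hv', hw']
    exact Submodule.inner_orthogonalProjectionOnto_eq_of_mem_right y _
  intro x y
  obtain ⟨v, w, hv, hw, h1⟩ := key x y
  obtain ⟨w', v', hw', hv', h2⟩ := key y x
  have hvv : v' = v := h.injective_fderiv u hu (hv'.symm.trans hv)
  have hww : w' = w := h.injective_fderiv u hu (hw'.symm.trans hw)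
  rw [← real_inner_comm x, h1, h2, hvv, hww, h.fderiv_fderiv_comm hu]

end OuterNormal

/-! ### Divergence theorem on the closed surface. -/

/-- The integrand of the divergence theorem on a closed surface. -/
noncomputable def divergenceDefect (Γ : Set E3) (n Z : E3 → E3) (s : E3) : ℝ :=
  tangentialDiv Γ Z s - tangentialDiv Γ n s * ⟪Z s, n s⟫

section OuterNormal

variable {Ω : Set E3} {n : E3 → E3}

theorem isCompact_frontier (hΩb : Bornology.IsBounded Ω) : IsCompact (frontier Ω) :=
  Metric.isCompact_of_isClosed_isBounded isClosed_frontier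
    (hΩb.closure.subset frontier_subset_closure)

theorem continuousOn_divergenceDefect (hΩ : IsOpen Ω) (hΓ : IsSmoothSurface (frontier Ω))
    (hn : IsOuterUnitNormal Ω n) {Z : E3 → E3} (hZ : ContDiffOn ℝ 1 Z (frontier Ω)) :
    ContinuousOn (divergenceDefect (frontier Ω) n Z) (frontier Ω) := by
  have hP := continuousOn_starProjection_tangentPlane hΩ hΓ hn
  have hn1 := contDiffOn_outerUnitNormal hn hΩ hΓ
  exact (continuousOn_tangentialDiv hP hZ).sub
    ((continuousOn_tangentialDiv hP hn1).mul (hZ.continuousOn.inner hn1.continuousOn))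

namespace IsLocalParametrization

variable {O : Set E3} {D : Set E2} {φ : E2 → E3}

/-- Expand the right-hand side by the product rule. The second derivatives of `φ` cancel by
symmetry. The terms with `DZ` form the trace identity for `D_Γ Z`, whose third term is absent since
`D_Γ Z n = 0`. In the terms with `Dn`, the other two entries besides `Z` are tangent, so only `⟪Z,
n⟫` survives, and the trace identity for `D_Γ n` produces `-(div_Γ n) ⟪Z, n⟫`. -/
theorem tripleProduct_mul_divergenceDefect (h : IsLocalParametrization (frontier Ω) O D φ)
    (hΩ : IsOpen Ω) (hΓ : IsSmoothSurface (frontier Ω)) (hn : IsOuterUnitNormal Ω n)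
    {Z : E3 → E3} (hZ : ContDiffOn ℝ 1 Z (frontier Ω)) {u : E2} (hu : u ∈ D) (v w : E2) :
    tripleProduct (fderiv ℝ φ u v) (fderiv ℝ φ u w) (n (φ u)) *
        divergenceDefect (frontier Ω) n Z (φ u) =
      fderiv ℝ (fun x => tripleProduct (Z (φ x)) (fderiv ℝ φ x w) (n (φ x))) u v +
        fderiv ℝ (fun x => tripleProduct (fderiv ℝ φ x v) (Z (φ x)) (n (φ x))) u w := by
  have hs := (h.mapsTo hu).1
  have hn1 := contDiffOn_outerUnitNormal hn hΩ hΓ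
  have hdZ := h.differentiableAt_comp hZ hu
  have hdn := h.differentiableAt_comp hn1 hu
  have hdφ : ∀ v, DifferentiableAt ℝ (fun x => fderiv ℝ φ x v) u := fun v =>
    (h.differentiableAt_fderiv hu).clm_apply (differentiableAt_const v)
  have hunit := (hn _ hs).1
  rw [fderiv_tripleProduct hdZ (hdφ w) hdn, fderiv_tripleProduct (hdφ v) hdZ hdn,
    h.fderiv_fderiv_apply hu, h.fderiv_fderiv_apply hu, h.fderiv_fderiv_comm hu w v]
  have e1 := tripleProduct_eq_neg_inner_mul (Z (φ u)) (fderiv ℝ φ u w)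
    (fderiv ℝ (fun x => n (φ x)) u v) _ hunit (h.inner_normal_fderiv hn hu w)
    (h.inner_fderiv_normal hΩ hΓ hn hu v)
  have e2 := tripleProduct_eq_neg_inner_mul (Z (φ u)) (fderiv ℝ φ u v)
    (fderiv ℝ (fun x => n (φ x)) u w) _ hunit (h.inner_normal_fderiv hn hu v)
    (h.inner_fderiv_normal hΩ hΓ hn hu w)
  have e3 := tripleProduct_swap (fderiv ℝ φ u v) (Z (φ u)) (fderiv ℝ (fun x => n (φ x)) u w)
  have e4 := tripleProduct_swap (fderiv ℝ (fun x => n (φ x)) u w) (fderiv ℝ φ u v) (n (φ u))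
  have e5 := tripleProduct_swap (Z (φ u)) (fderiv ℝ (fderiv ℝ φ) u v w) (n (φ u))
  have tZ := tripleProduct_trace (tangentialDeriv (frontier Ω) Z (φ u)) (fderiv ℝ φ u v)
    (fderiv ℝ φ u w) (n (φ u))
  have tn := tripleProduct_trace (tangentialDeriv (frontier Ω) n (φ u)) (fderiv ℝ φ u v)
    (fderiv ℝ φ u w) (n (φ u))
  have hz0 : ∀ x y, tripleProduct x y 0 = 0 := fun x y => by simp [tripleProduct]
  rw [tangentialDeriv_normal_eq_zero hn hs, hz0, add_zero, ← tangentialDiv_eq_trace,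
    ← h.fderiv_comp_apply hu (hZ.differentiableOn one_ne_zero _ hs),
    ← h.fderiv_comp_apply hu (hZ.differentiableOn one_ne_zero _ hs)] at tZ
  rw [tangentialDeriv_normal_eq_zero hn hs, hz0, add_zero, ← tangentialDiv_eq_trace,
    ← h.fderiv_comp_apply hu (hn1.differentiableOn one_ne_zero _ hs),
    ← h.fderiv_comp_apply hu (hn1.differentiableOn one_ne_zero _ hs)] at tn
  rw [divergenceDefect, mul_sub, mul_comm _ (tangentialDiv _ Z _), ← tZ, mul_left_comm,
    ← mul_assoc, ← tn, e1, e3, e2, e4, e5, real_inner_comm (n (φ u)) (Z (φ u))]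
  ring

/-- The Jacobian of a parametrization is a triple product, up to a constant sign. -/
theorem exists_normDet_eq (h : IsLocalParametrization (frontier Ω) O D φ)
    (hΩ : IsOpen Ω) (hΓ : IsSmoothSurface (frontier Ω)) (hn : IsOuterUnitNormal Ω n) :
    ∃ τ : ℝ, ∀ u ∈ D, (fderiv ℝ φ u).toLinearMap.normDet =
      τ * tripleProduct (fderiv ℝ φ u (EuclideanSpace.single 0 1))
        (fderiv ℝ φ u (EuclideanSpace.single 1 1)) (n (φ u)) := by
  set d : E2 → ℝ := fun u => tripleProduct (fderiv ℝ φ u (EuclideanSpace.single 0 1))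
        (fderiv ℝ φ u (EuclideanSpace.single 1 1)) (n (φ u)) with hd
  have habs : ∀ u ∈ D, |d u| = (fderiv ℝ φ u).toLinearMap.normDet := fun u hu =>
    abs_tripleProduct_eq_normDet _ _ (hn _ (h.mapsTo hu).1).1 (h.inner_normal_fderiv hn hu)
  have hne : ∀ u ∈ D, d u ≠ 0 := fun u hu => by
    rw [← abs_pos, habs u hu]
    exact normDet_pos (h.injective_fderiv u hu)
  have hc : ContinuousOn d D :=
    (contDiff_tripleProduct (k := 0)).continuous.comp_continuousOn
      ((h.contDiffOn_fderiv_apply _).continuousOn.prodMk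
        ((h.contDiffOn_fderiv_apply _).continuousOn.prodMk
          (h.contDiffOn_comp (contDiffOn_outerUnitNormal hn hΩ hΓ)).continuousOn))
  -- The continuous function `d` has no zero on the connected set `D`, so it keeps one sign there.
  by_cases hneg : ∃ u ∈ D, d u < 0
  · obtain ⟨u, hu, hlt⟩ := hneg
    refine ⟨-1, fun w hw => ?_⟩
    have : d w ≤ 0 := by
      by_contra hcon
      obtain ⟨z, hz, hz0⟩ := h.isPreconnected.intermediate_value hu hw hc
        ⟨hlt.le, (not_le.1 hcon).le⟩
      exact hne z hz hz0
    rw [← habs w hw, abs_of_nonpos this]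
    ring
  · push Not at hneg
    exact ⟨1, fun w hw => by rw [← habs w hw, abs_of_nonneg (hneg w hw), one_mul]⟩

theorem setIntegral_divergenceDefect_eq_zero (h : IsLocalParametrization (frontier Ω) O D φ)
    (hΩ : IsOpen Ω) (hΩb : Bornology.IsBounded Ω) (hΓ : IsSmoothSurface (frontier Ω))
    (hn : IsOuterUnitNormal Ω n) {Z : E3 → E3} (hZ : ContDiffOn ℝ 1 Z (frontier Ω)) {C : Set E3}
    (hC : IsClosed C) (hCO : C ⊆ O) (hZC : ∀ s ∈ frontier Ω, s ∉ C → Z s = 0) :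
    ∫ s in frontier Ω, divergenceDefect (frontier Ω) n Z s ∂μHE[2] = 0 := by
  have hcpt := isCompact_frontier hΩb
  have hn1 := contDiffOn_outerUnitNormal hn hΩ hΓ
  have hX0 : ∀ s ∈ frontier Ω, s ∉ C → divergenceDefect (frontier Ω) n Z s = 0 := by
    intro s hs hsC
    have h1 : Z =ᶠ[𝓝[frontier Ω] s] fun _ => 0 := by
      filter_upwards [self_mem_nhdsWithin,
        mem_nhdsWithin_of_mem_nhds (hC.isOpen_compl.mem_nhds hsC)] with x hx hxC
      exact hZC x hx hxC
    have h2 : tangentialDeriv (frontier Ω) Z s = 0 := by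
      rw [tangentialDeriv_congr h1 (hZC s hs hsC),
        tangentialDeriv_eq (hasFDerivWithinAt_const (0 : E3) s (frontier Ω))]
      simp
    rw [divergenceDefect, tangentialDiv_eq_trace, h2, hZC s hs hsC]
    simp
  rw [setIntegral_eq_of_subset_of_forall_sdiff_eq_zero (s := φ '' D)
    isClosed_frontier.measurableSet (by rw [h.image_eq]; exact inter_subset_left)
    (fun s hs => hX0 s hs.1 fun hsC => hs.2 (by rw [h.image_eq]; exact ⟨hs.1, hCO hsC⟩))]
  have hrank : Module.finrank ℝ E2 = 2 := by simp
  have hcov := setIntegral_image_eq_integral_normDet_mul h.isOpen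
    (h.contDiffOn.of_le (by norm_num)) h.injOn h.injective_fderiv
    (g := divergenceDefect (frontier Ω) n Z)
    ((continuousOn_divergenceDefect hΩ hΓ hn hZ).mono
      (by rw [h.image_eq]; exact inter_subset_left))
  rw [hrank] at hcov
  rw [hcov]
  obtain ⟨τ, hτ⟩ := h.exists_normDet_eq hΩ hΓ hn
  obtain ⟨ψ, hψ, hψφ⟩ := h.exists_leftInverse
  -- The continuous left inverse of `φ` carries the compact set containing the support of `Z` on the
  -- surface to a compact subset of `D`, so boundary terms vanish in the parameter plane.
  set K : Set E2 := ψ '' (frontier Ω ∩ C) with hK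
  have hKc : IsCompact K := (hcpt.inter_right hC).image_of_continuousOn
    (hψ.mono fun s hs => hCO hs.2)
  have hKD : K ⊆ D := by
    rintro _ ⟨s, ⟨hs, hsC⟩, rfl⟩
    have : s ∈ φ '' D := by rw [h.image_eq]; exact ⟨hs, hCO hsC⟩
    obtain ⟨u, hu, rfl⟩ := this
    rwa [hψφ u hu]
  have hZK : ∀ u ∈ D, u ∉ K → Z (φ u) = 0 := fun u hu huK =>
    hZC _ (h.mapsTo hu).1 fun huC => huK ⟨φ u, ⟨(h.mapsTo hu).1, huC⟩, hψφ u hu⟩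
  have hdD : ∀ v, ContDiffOn ℝ 1 (fun u => fderiv ℝ φ u v) D := fun v =>
    h.contDiffOn_fderiv_apply v
  set v : E2 := EuclideanSpace.single 0 1
  set w : E2 := EuclideanSpace.single 1 1
  set G₁ : E2 → ℝ := fun x => tripleProduct (Z (φ x)) (fderiv ℝ φ x w) (n (φ x))
  set G₂ : E2 → ℝ := fun x => tripleProduct (fderiv ℝ φ x v) (Z (φ x)) (n (φ x))
  have hG₁ : ContDiffOn ℝ 1 G₁ D := contDiff_tripleProduct.comp_contDiffOn
    ((h.contDiffOn_comp hZ).prodMk ((hdD w).prodMk (h.contDiffOn_comp hn1)))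
  have hG₂ : ContDiffOn ℝ 1 G₂ D := contDiff_tripleProduct.comp_contDiffOn
    ((hdD v).prodMk ((h.contDiffOn_comp hZ).prodMk (h.contDiffOn_comp hn1)))
  have h0 : ∀ (y z : E3), tripleProduct 0 y z = 0 ∧ tripleProduct y 0 z = 0 := fun y z => by
    simp [tripleProduct]
  have hi₁ := integral_fderiv_eq_zero_of_compact (μ := volume) h.isOpen hG₁ hKc hKD
    (fun u hu huK => by simp only [G₁, hZK u hu huK, (h0 _ _).1]) v
  have hi₂ := integral_fderiv_eq_zero_of_compact (μ := volume) h.isOpen hG₂ hKc hKD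
    (fun u hu huK => by simp only [G₂, hZK u hu huK, (h0 _ _).2]) w
  have hint : ∀ {G : E2 → ℝ} (v : E2), ContDiffOn ℝ 1 G D → (∀ u ∈ D, u ∉ K → G u = 0) →
      IntegrableOn (fun u => fderiv ℝ G u v) D := by
    intro G v hG hG0
    have hcont : ContinuousOn (fun u => fderiv ℝ G u v) K :=
      ((hG.continuousOn_fderiv_of_isOpen h.isOpen le_rfl).clm_apply continuousOn_const).mono hKD
    refine (hcont.integrableOn_compact hKc).of_forall_sdiff_eq_zero h.isOpen.measurableSet
      fun u hu => ?_
    have : G =ᶠ[𝓝 u] fun _ => 0 := by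
      filter_upwards [h.isOpen.mem_nhds hu.1, hKc.isClosed.isOpen_compl.mem_nhds hu.2] with x hx hxK
      exact hG0 x hx hxK
    rw [this.fderiv_eq]
    simp
  calc ∫ u in D, (fderiv ℝ φ u).toLinearMap.normDet * divergenceDefect (frontier Ω) n Z (φ u)
      = ∫ u in D, τ * (fderiv ℝ G₁ u v + fderiv ℝ G₂ u w) :=
        setIntegral_congr_fun h.isOpen.measurableSet fun u hu => by
          rw [hτ u hu, mul_assoc, h.tripleProduct_mul_divergenceDefect hΩ hΓ hn hZ hu]
    _ = 0 := by
        rw [integral_const_mul, integral_add, hi₁, hi₂]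
        · simp
        · exact hint v hG₁ fun u hu huK => by simp only [G₁, hZK u hu huK, (h0 _ _).1]
        · exact hint w hG₂ fun u hu huK => by simp only [G₂, hZK u hu huK, (h0 _ _).2]

/-- A surface has locally finite area. -/
theorem finiteAtFilter {Γ : Set E3} (h : IsLocalParametrization Γ O D φ) {s : E3} (hs : s ∈ Γ)
    (hsO : s ∈ O) : (μHE[2] : Measure E3).FiniteAtFilter (𝓝[Γ] s) := by
  have : s ∈ φ '' D := by rw [h.image_eq]; exact ⟨hs, hsO⟩
  obtain ⟨u, hu, rfl⟩ := this
  have hφ1 : ContDiffOn ℝ 1 φ D := h.contDiffOn.of_le (by norm_num)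
  have hJ : ContinuousAt (fun u => (fderiv ℝ φ u).toLinearMap.normDet) u :=
    continuous_normDet.continuousAt.comp
      ((hφ1.continuousOn_fderiv_of_isOpen h.isOpen le_rfl).continuousAt (h.isOpen.mem_nhds hu))
  set c := (fderiv ℝ φ u).toLinearMap.normDet + 1
  have hlt : ∀ᶠ w in 𝓝 u, (fderiv ℝ φ w).toLinearMap.normDet < c :=
    hJ.eventually_lt_const (lt_add_one _)
  obtain ⟨ρ, hρ, hball⟩ := Metric.mem_nhds_iff.1 (inter_mem (h.isOpen.mem_nhds hu) hlt)
  obtain ⟨ψ, hψ, hψφ⟩ := h.exists_leftInverse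
  refine ⟨φ '' Metric.ball u ρ, ?_, ?_⟩
  · have h1 : ψ ⁻¹' Metric.ball u ρ ∈ 𝓝 (φ u) := by
      refine (hψ.continuousAt (h.isOpen_target.mem_nhds hsO)).preimage_mem_nhds ?_
      rw [hψφ u hu]
      exact Metric.ball_mem_nhds u hρ
    filter_upwards [self_mem_nhdsWithin, mem_nhdsWithin_of_mem_nhds h1,
      mem_nhdsWithin_of_mem_nhds (h.isOpen_target.mem_nhds hsO)] with x hx hxψ hxO
    have : x ∈ φ '' D := by rw [h.image_eq]; exact ⟨hx, hxO⟩
    obtain ⟨w, hw, rfl⟩ := this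
    rw [mem_preimage, hψφ w hw] at hxψ
    exact ⟨w, hxψ, rfl⟩
  · have hrank : Module.finrank ℝ E2 = 2 := by simp
    have harea := euclideanHausdorffMeasure_image_eq_lintegral_normDet h.isOpen hφ1 h.injOn
      h.injective_fderiv (E := Metric.ball u ρ) measurableSet_ball fun w hw => (hball hw).1
    rw [hrank] at harea
    rw [harea]
    calc _ ≤ ∫⁻ _ in Metric.ball u ρ, ENNReal.ofReal c :=
          setLIntegral_mono' measurableSet_ball fun w hw =>
            ENNReal.ofReal_le_ofReal (le_of_lt (hball hw).2)
      _ < ⊤ := by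
          rw [setLIntegral_const]
          exact ENNReal.mul_lt_top ENNReal.ofReal_lt_top measure_ball_lt_top

end IsLocalParametrization

theorem IsCompact.surface_area_lt_top {Γ : Set E3} (hc : IsCompact Γ) (hΓ : IsSmoothSurface Γ) :
    (μHE[2] : Measure E3) Γ < ⊤ := by
  refine hc.measure_lt_top_of_nhdsWithin fun s hs => ?_
  obtain ⟨O, D, φ, h, hsO⟩ := exists_isLocalParametrization hΓ hs
  exact h.finiteAtFilter hs hsO

theorem ContinuousOn.integrable_surfaceMeasure {Γ : Set E3} {g : E3 → ℝ} (hg : ContinuousOn g Γ)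
    (hc : IsCompact Γ) (hΓ : IsSmoothSurface Γ) : Integrable g (surfaceMeasure Γ) := by
  obtain ⟨C, hC⟩ := hc.exists_bound_of_continuousOn hg
  exact IntegrableOn.of_bound (hc.surface_area_lt_top hΓ)
    (hg.aestronglyMeasurable hc.isClosed.measurableSet) C
    ((ae_restrict_iff' hc.isClosed.measurableSet).2 (Eventually.of_forall hC))

/-- The **divergence theorem** on the boundary of a bounded domain, for vector fields which need
not be tangential. -/
theorem integral_divergenceDefect_eq_zero (hΩ : IsOpen Ω) (hΩb : Bornology.IsBounded Ω)
    (hΓ : IsSmoothSurface (frontier Ω)) (hn : IsOuterUnitNormal Ω n) {Z : E3 → E3}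
    (hZ : ContDiffOn ℝ 1 Z (frontier Ω)) :
    ∫ s, divergenceDefect (frontier Ω) n Z s ∂(surfaceMeasure (frontier Ω)) = 0 := by
  have hcpt := isCompact_frontier hΩb
  choose! O D φ h hO using fun p (hp : p ∈ frontier Ω) => exists_isLocalParametrization hΓ hp
  obtain ⟨t, htΓ, ht⟩ := hcpt.elim_nhds_subcover O fun p hp =>
    (h p hp).isOpen_target.mem_nhds (hO p hp)
  obtain ⟨χ, hχ⟩ := SmoothPartitionOfUnity.exists_isSubordinate (modelWithCornersSelf ℝ E3)
    (s := frontier Ω) isClosed_frontier (fun i : t => O i)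
    (fun i => (h i (htΓ i i.2)).isOpen_target) (by
      refine ht.trans fun x hx => ?_
      simp only [mem_iUnion] at hx ⊢
      obtain ⟨i, hi, hxi⟩ := hx
      exact ⟨⟨i, hi⟩, hxi⟩)
  have hχs : ∀ i, ContDiff ℝ 1 (χ i) := fun i =>
    (χ i).contMDiff.contDiff.of_le (WithTop.coe_le_coe.2 le_top : ((1 : ℕ∞) : WithTop ℕ∞) ≤ ∞)
  set Y : t → E3 → E3 := fun i x => χ i x • Z x with hY
  have hYs : ∀ i, ContDiffOn ℝ 1 (Y i) (frontier Ω) := fun i => (hχs i).contDiffOn.smul hZ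
  have hsum : ∀ s ∈ frontier Ω, ∑ i, Y i s = Z s := fun s hs => by
    have h1 := χ.sum_eq_one hs
    rw [finsum_eq_sum_of_fintype] at h1
    rw [hY, ← Finset.sum_smul, h1, one_smul]
  -- The defect is additive in the field, so it suffices to treat the pieces `χ i • Z`, each
  -- supported in one chart.
  have hdiv : ∀ s ∈ frontier Ω, divergenceDefect (frontier Ω) n Z s =
      ∑ i, divergenceDefect (frontier Ω) n (Y i) s := fun s hs => by
    have h1 : tangentialDeriv (frontier Ω) Z s =
        ∑ i, tangentialDeriv (frontier Ω) (Y i) s := by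
      rw [← tangentialDeriv_sum fun i _ => (hYs i).differentiableOn one_ne_zero s hs]
      refine tangentialDeriv_congr ?_ (hsum s hs).symm
      filter_upwards [self_mem_nhdsWithin] with x hx
      exact (hsum x hx).symm
    simp only [divergenceDefect, Finset.sum_sub_distrib, tangentialDiv_eq_trace,
      ← Finset.mul_sum, ← sum_inner]
    rw [hsum s hs, h1, ContinuousLinearMap.toLinearMap_sum, map_sum]
  have hcongr : ∫ s, divergenceDefect (frontier Ω) n Z s ∂(surfaceMeasure (frontier Ω)) =
      ∫ s, ∑ i, divergenceDefect (frontier Ω) n (Y i) s ∂(surfaceMeasure (frontier Ω)) :=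
    setIntegral_congr_fun isClosed_frontier.measurableSet hdiv
  rw [hcongr, integral_finsetSum]
  · refine Finset.sum_eq_zero fun i _ => ?_
    refine (h i (htΓ i i.2)).setIntegral_divergenceDefect_eq_zero hΩ hΩb hΓ hn (hYs i)
      (isClosed_tsupport (χ i)) (hχ i) fun s _ hs => ?_
    simp only [hY, image_eq_zero_of_notMem_tsupport hs, zero_smul]
  · exact fun i _ => (continuousOn_divergenceDefect hΩ hΓ hn (hYs i)).integrable_surfaceMeasure
      hcpt hΓ

end OuterNormal

theorem mainTheorem6 (Ω : Set E3) (hΩ : IsOpen Ω) (hΩb : Bornology.IsBounded Ω)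
    (Γ : Set E3) (hΓ : Γ = frontier Ω) (hΓs : IsSmoothSurface Γ)
    (n : E3 → E3) (hn : IsOuterUnitNormal Ω n)
    (a b V : E3 → E3)
    (ha : ContDiffOn ℝ 1 a Γ) (hb : ContDiffOn ℝ 1 b Γ) (hV : ContDiffOn ℝ 1 V Γ)
    (hVn : ∀ s ∈ Γ, V s = ⟪V s, n s⟫ • n s) :
    Integrable (fun s => ⟪a s, tangentialDeriv Γ V s (b s)⟫) (surfaceMeasure Γ) ∧
    Integrable (fun s => ⟪V s, n s⟫ *
      (-tangentialDiv Γ (fun x => ⟪a x, n x⟫ • b x) s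
        + ⟪a s, n s⟫ * ⟪b s, n s⟫ * (principalCurvatures Γ n s).sum
        + ⟪a s, tangentialDeriv Γ n s (b s)⟫)) (surfaceMeasure Γ) ∧
    ∫ s, ⟪a s, tangentialDeriv Γ V s (b s)⟫ ∂(surfaceMeasure Γ) =
      ∫ s, ⟪V s, n s⟫ *
        (-tangentialDiv Γ (fun x => ⟪a x, n x⟫ • b x) s
          + ⟪a s, n s⟫ * ⟪b s, n s⟫ * (principalCurvatures Γ n s).sum
          + ⟪a s, tangentialDeriv Γ n s (b s)⟫) ∂(surfaceMeasure Γ) := by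
  subst hΓ
  have hcpt := isCompact_frontier hΩb
  have hP := continuousOn_starProjection_tangentPlane hΩ hΓs hn
  have hn1 := contDiffOn_outerUnitNormal hn hΩ hΓs
  have hv : ContDiffOn ℝ 1 (fun x => ⟪V x, n x⟫) (frontier Ω) := hV.inner ℝ hn1
  have hW : ContDiffOn ℝ 1 (fun x => ⟪a x, n x⟫ • b x) (frontier Ω) := (ha.inner ℝ hn1).smul hb
  have hZ : ContDiffOn ℝ 1 (fun x => ⟪V x, n x⟫ • ⟪a x, n x⟫ • b x) (frontier Ω) := hv.smul hW
  have hcurv : ∀ s ∈ frontier Ω, (principalCurvatures (frontier Ω) n s).sum =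
      tangentialDiv (frontier Ω) n s := fun s hs =>
    sum_principalCurvatures (isSymmetric_shapeOperator hΩ hΓs hn hs)
  have hI1 : Integrable (fun s => ⟪a s, tangentialDeriv (frontier Ω) V s (b s)⟫)
      (surfaceMeasure (frontier Ω)) :=
    ContinuousOn.integrable_surfaceMeasure (ha.continuousOn.inner
      ((continuousOn_tangentialDeriv hP hV).clm_apply hb.continuousOn)) hcpt hΓs
  have hI2 : Integrable (fun s => ⟪V s, n s⟫ *
      (-tangentialDiv (frontier Ω) (fun x => ⟪a x, n x⟫ • b x) s
        + ⟪a s, n s⟫ * ⟪b s, n s⟫ * (principalCurvatures (frontier Ω) n s).sum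
        + ⟪a s, tangentialDeriv (frontier Ω) n s (b s)⟫)) (surfaceMeasure (frontier Ω)) := by
    refine ContinuousOn.integrable_surfaceMeasure (ContinuousOn.mul hv.continuousOn
      (ContinuousOn.add (ContinuousOn.add (continuousOn_tangentialDiv hP hW).neg ?_) ?_)) hcpt hΓs
    · exact ((ha.inner ℝ hn1).continuousOn.mul (hb.inner ℝ hn1).continuousOn).mul
        ((continuousOn_tangentialDiv hP hn1).congr hcurv)
    · exact ha.continuousOn.inner ((continuousOn_tangentialDeriv hP hn1).clm_apply hb.continuousOn)
  refine ⟨hI1, hI2, ?_⟩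
  -- The zero on the right is replaced by the integral of the defect of `Z = ⟪V, n⟫ • ⟪a, n⟫ • b`,
  -- which leaves a pointwise identity given by the product rules.
  rw [← sub_eq_zero, ← integral_sub hI1 hI2, ← integral_divergenceDefect_eq_zero hΩ hΩb hΓs hn hZ]
  refine setIntegral_congr_fun isClosed_frontier.measurableSet fun s hs => ?_
  have hdv := hv.differentiableOn one_ne_zero s hs
  have hVeq : tangentialDeriv (frontier Ω) V s =
      tangentialDeriv (frontier Ω) (fun x => ⟪V x, n x⟫ • n x) s := by
    refine tangentialDeriv_congr ?_ (hVn s hs)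
    filter_upwards [self_mem_nhdsWithin] with x hx
    exact hVn x hx
  simp only [divergenceDefect]
  rw [hcurv s hs, hVeq, tangentialDeriv_smul hdv (hn1.differentiableOn one_ne_zero s hs),
    tangentialDiv_smul hdv (hW.differentiableOn one_ne_zero s hs)]
  simp only [add_apply, smul_apply,
    ContinuousLinearMap.smulRight_apply, ContinuousLinearMap.comp_apply, inner_add_right,
    real_inner_smul_right, real_inner_smul_left, map_smul, smul_eq_mul]
  ring
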